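/- Let $V:\mathbb R^d\to\mathbb R^d$ be a measurable operator, $\mathcal X^*=\{x: V(x)=0\}$, and let $R\in\mathbb R$, $\lambda\ge 0$, $\mu>0$, $\sigma>0$. Assume: (1) there is a point of $\mathcal X^*$ of norm at most $R$; (2) for some $x^*\in\mathcal X^*$, $\langle V(x),x-x^*\rangle\ge\mu\|x-x^*\|^2-\lambda$ for all $x\in\mathbb R^d$; (3) in the case of SGDA, $\|V(x)\|\le G(1+\|x\|)$ for all $x$, with $G>0$; in the case of SEG, $V$ is $L$-Lipschitz; (4) the noises $U_n(\cdot)$, $n\in\mathbb N$ (for SEG: $U_n(\cdot)$ and $U_{n+1/2}(\cdot)$, $n\in\mathbb N$) are independent, identically distributed, jointly measurable random fields $\mathbb R^d\to\mathbb R^d$ on a probability space with a filtration $(\mathcal F_n)$; $U_n$ (and $U_{n+1/2}$) is $\mathcal F_{n+1}$-measurable, and for every $x$ the variable $W=U_n(x)$ (and $W=U_{n+1/2}(x)$) is square-integrable with $\mathbb E[W\mid\mathcal F_n]=0$ and $\mathbb E[\|W\|^2\mid\mathcal F_n]\le\sigma^2$; (5) each of these noise fields $U$ decomposes as $U(x)=U^a(x)+U^b(x)$,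 where for each $x$ the variables $U^a(x)$ and $U^b(x)$ are independent and $U^a(x)$ has a Lebesgue density $p_x$, such that $\inf_{x\in C}p_x(t)>0$ for every bounded $C\subseteq\mathbb R^d$ and every $t\in\mathbb R^d$. Consider, from a deterministic starting point $x_0$, the iterates SGDA: $x_{n+1}=x_n-\gamma\,(V(x_n)+U_n(x_n))$, with $0<\gamma<\mu/G^2$; or SEG: $x_{n+1/2}=x_n-\gamma\,(V(x_n)+U_n(x_n))$, $x_{n+1}=x_n-\alpha\gamma\,(V(x_{n+1/2})+U_{n+1/2}(x_{n+1/2}))$, with $0<\gamma<\frac1{2\mu+\sqrt3L}$ and $\alpha\in(0,1)$. Then for each of the two algorithms: (i) the Markov chain $(x_n)$ has a unique stationary distribution $\pi_\gamma$, and $\int\|x\|^2\,d\pi_\gamma<\infty$. (ii) For every measurable $\ell:\mathbb R^d\to\mathbb R$ with $|\ell(x)|\le G_\ell(1+\|x\|)$ for all $x$ and some $G_\ell>0$, all the expectations below are finite, and there is $\rho\in(0,1)$, independent of $x_0$, such that for every $x_0$ there is $c\in(0,\infty)$ with $$\bigl|\mathbb E[\ell(x_n)]-\mathbb E_{x\sim\pi_\gamma}[\ell(x)]\bigr|\le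 c\,\rho^n\qquad\text{for all } n\ge0.$$ Moreover the law of $x_n$ converges geometrically to $\pi_\gamma$ in total variation: there is $\rho\in(0,1)$ such that for every $x_0$ there is $c\in(0,\infty)$ with $d_{TV}(\mathrm{law}(x_n),\pi_\gamma)\le c\,\rho^n$ for all $n\ge0$. (iii) For every $L_\ell$-Lipschitz $\ell:\mathbb R^d\to\mathbb R$ and every $x^*\in\mathcal X^*$, $$\bigl|\mathbb E_{x\sim\pi_\gamma}[\ell(x)]-\ell(x^*)\bigr|\le L_\ell\sqrt D,\qquad D=K\,\frac{\max(\lambda,\gamma)}{\mu},$$ where the constant $K>0$ depends only on $G,R,\sigma$ for SGDA and only on $\alpha,\sigma$ for SEG (in particular not on $\lambda,\mu,\gamma$). -/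

import Mathlib

open MeasureTheory ProbabilityTheory
open scoped ENNReal NNReal

universe u

noncomputable section

namespace StochVI

/-- `ℝ^d` with its Euclidean norm. -/
abbrev Vec (d : ℕ) : Type := EuclideanSpace ℝ (Fin d)

/-- Solutions of the unconstrained variational inequality: the zeros of the operator. -/
def solutions {d : ℕ} (V : Vec d → Vec d) : Set (Vec d) := {x | V x = 0}

/-- `lam`-weak `μ`-quasi strong monotonicity, with respect to some solution. -/
def WeakQuasiStronglyMonotone {d : ℕ} (V : Vec d → Vec d) (lam μ : ℝ) : Prop :=
  ∃ xs ∈ solutions V, ∀ x, μ * ‖x - xs‖ ^ 2 - lam ≤ inner ℝ (V x) (x - xs)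

/-- At most `G`-linear growth. -/
def LinearGrowth {d : ℕ} (V : Vec d → Vec d) (G : ℝ) : Prop :=
  ∀ x, ‖V x‖ ≤ G * (1 + ‖x‖)

/-- A family `U k` of independent, identically distributed measurable random fields on `ℝ^d`.
The fields carry independent σ-algebras, and `U k` is jointly measurable in the point and in the
information of its own σ-algebra, so that evaluating it at an independent random point makes sense.
Equality in law is equality of the laws of the processes `(U k x)_x`. -/
structure IIDFields {d : ℕ} {κ Ω : Type*} [MeasurableSpace Ω] (P : Measure Ω)
    (U : κ → Vec d → Ω → Vec d) : Prop where
  indep : ∃ 𝒢 : κ → MeasurableSpace Ω, (∀ k, 𝒢 k ≤ ‹MeasurableSpace Ω›) ∧ iIndep 𝒢 P ∧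
    ∀ k, Measurable[MeasurableSpace.prod inferInstance (𝒢 k)]
      (fun q : Vec d × Ω => U k q.1 q.2)
  ident : ∀ k l, IdentDistrib (fun ω x => U k x ω) (fun ω x => U l x ω) P P

/-- The noise of a stochastic oracle.  The queries are indexed by `κ`; the `k`-th query is made
on the basis of the history `ℱ (time k)`, and its answer is known at time `time k + 1`. -/
structure OracleNoise {d : ℕ} {κ Ω : Type*} [mΩ : MeasurableSpace Ω] (P : Measure Ω)
    (ℱ : Filtration ℕ mΩ) (time : κ → ℕ) (U : κ → Vec d → Ω → Vec d) (σ : ℝ) : Prop where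
  iid : IIDFields P U
  adapted : ∀ k, Measurable[MeasurableSpace.prod inferInstance (ℱ (time k + 1))]
    (fun q : Vec d × Ω => U k q.1 q.2)
  sq_integrable : ∀ k x, MemLp (U k x) 2 P
  zero_mean : ∀ k x, P[U k x | ℱ (time k)] =ᵐ[P] 0
  second_moment : ∀ k x, P[fun ω => ‖U k x ω‖ ^ 2 | ℱ (time k)] ≤ᵐ[P] fun _ => σ ^ 2

/-- Every field splits pointwise as `Ua x + Ub x` with `Ua x`, `Ub x` independent, where `Ua x` has
a Lebesgue density `p x`, and on each bounded set of points `x` the densities are bounded below at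
each `t` by a positive number. -/
def PositiveDensityPart {d : ℕ} {κ Ω : Type*} [MeasurableSpace Ω] (P : Measure Ω)
    (U : κ → Vec d → Ω → Vec d) : Prop :=
  ∀ k, ∃ (Ua Ub : Vec d → Ω → Vec d) (p : Vec d → Vec d → ℝ≥0∞),
    (∀ x ω, U k x ω = Ua x ω + Ub x ω) ∧
    (∀ x, Measurable (Ua x) ∧ IndepFun (Ua x) (Ub x) P) ∧
    (∀ x, Measurable (p x) ∧ P.map (Ua x) = volume.withDensity (p x)) ∧
    ∀ C : Set (Vec d), Bornology.IsBounded C → ∀ t, 0 < ⨅ x ∈ C, p x t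

/-- One SGDA update from `x`, with noise field `u`. -/
def sgdaStep {d : ℕ} (V : Vec d → Vec d) (γ : ℝ) (u : Vec d → Vec d) (x : Vec d) : Vec d :=
  x - γ • (V x + u x)

/-- One (double step-size) SEG update from `x`, with noise field `u` for the look-ahead step and
`u'` for the update step. -/
def segStep {d : ℕ} (V : Vec d → Vec d) (α γ : ℝ) (u u' : Vec d → Vec d) (x : Vec d) : Vec d :=
  let y := x - γ • (V x + u x)
  x - (α * γ) • (V y + u' y)

/-- The SGDA iterates started at `x₀`. -/
def sgda {d : ℕ} {Ω : Type*} (V : Vec d → Vec d) (γ : ℝ) (U : ℕ → Vec d → Ω → Vec d)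
    (x₀ : Vec d) : ℕ → Ω → Vec d
  | 0, _ => x₀
  | n + 1, ω => sgdaStep V γ (fun x => U n x ω) (sgda V γ U x₀ n ω)

/-- The SEG iterates started at `x₀`; `U n` and `U' n` are the noises at times `n`, `n + 1/2`. -/
def seg {d : ℕ} {Ω : Type*} (V : Vec d → Vec d) (α γ : ℝ) (U U' : ℕ → Vec d → Ω → Vec d)
    (x₀ : Vec d) : ℕ → Ω → Vec d
  | 0, _ => x₀
  | n + 1, ω => segStep V α γ (fun x => U n x ω) (fun x => U' n x ω) (seg V α γ U U' x₀ n ω)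

/-- The Markov kernel sending `x` to the law of the random update `F x` under `P`. -/
def updateKernel {d : ℕ} {Ω : Type*} [MeasurableSpace Ω] (P : Measure Ω)
    (F : Vec d → Ω → Vec d) : Kernel (Vec d) (Vec d) :=
  (Kernel.id ×ₖ Kernel.const (Vec d) P).map (fun q : Vec d × Ω => F q.1 q.2)

/-- The transition kernel of SGDA (by homogeneity in time, that of the first step). -/
def sgdaKernel {d : ℕ} {Ω : Type*} [MeasurableSpace Ω] (P : Measure Ω) (V : Vec d → Vec d) (γ : ℝ)
    (U : ℕ → Vec d → Ω → Vec d) : Kernel (Vec d) (Vec d) :=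
  updateKernel P fun x ω => sgdaStep V γ (fun y => U 0 y ω) x

/-- The transition kernel of SEG (by homogeneity in time, that of the first step). -/
def segKernel {d : ℕ} {Ω : Type*} [MeasurableSpace Ω] (P : Measure Ω) (V : Vec d → Vec d) (α γ : ℝ)
    (U U' : ℕ → Vec d → Ω → Vec d) : Kernel (Vec d) (Vec d) :=
  updateKernel P fun x ω => segStep V α γ (fun y => U 0 y ω) (fun y => U' 0 y ω) x

/-- Total variation distance of two probability measures. -/
def tvDist {d : ℕ} (ν π : Measure (Vec d)) : ℝ :=
  ⨆ A : {A : Set (Vec d) // MeasurableSet A}, |ν.real A - π.real A|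

/-- `π` is the unique stationary distribution of the chain with kernel `Q`, it has finite second
moment, and it is the geometric limit in law of the iterates `X x₀` from every `x₀`, both for
test functions of linear growth and in total variation. -/
structure IsGeometricLimit {d : ℕ} {Ω : Type*} [MeasurableSpace Ω] (P : Measure Ω)
    (Q : Kernel (Vec d) (Vec d)) (X : Vec d → ℕ → Ω → Vec d) (π : Measure (Vec d)) : Prop where
  prob : IsProbabilityMeasure π
  invariant : Q.Invariant π
  unique : ∀ π' : Measure (Vec d), IsProbabilityMeasure π' → Q.Invariant π' → π' = π
  second_moment : Integrable (fun x => ‖x‖ ^ 2) π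
  test_function : ∀ f : Vec d → ℝ, Measurable f →
    (∃ Gf : ℝ, 0 < Gf ∧ ∀ x, |f x| ≤ Gf * (1 + ‖x‖)) →
    Integrable f π ∧
    ∃ ρ : ℝ, 0 < ρ ∧ ρ < 1 ∧ ∀ x₀ : Vec d, ∃ c : ℝ, 0 < c ∧ ∀ n : ℕ,
      Integrable (fun ω => f (X x₀ n ω)) P ∧
      |(∫ ω, f (X x₀ n ω) ∂P) - ∫ x, f x ∂π| ≤ c * ρ ^ n
  total_variation : ∃ ρ : ℝ, 0 < ρ ∧ ρ < 1 ∧ ∀ x₀ : Vec d, ∃ c : ℝ, 0 < c ∧ ∀ n : ℕ,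
    tvDist (P.map (X x₀ n)) π ≤ c * ρ ^ n

/-- For Lipschitz test functions the stationary mean is within `Lf * √D` of the value at any
solution. -/
def LipschitzBias {d : ℕ} (V : Vec d → Vec d) (π : Measure (Vec d)) (D : ℝ) : Prop :=
  ∀ (f : Vec d → ℝ) (Lf : ℝ≥0), LipschitzWith Lf f → ∀ xs ∈ solutions V,
    |(∫ x, f x ∂π) - f xs| ≤ Lf * √D

end StochVI

end

/-!
Let `xs` be a solution with respect to which `V` is weakly quasi-strongly monotone. One step of
either algorithm multiplies the mean of `‖x - xs‖ ^ 2` by a factor less than `1`, up to an additive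
constant: this is a Foster–Lyapunov drift. On the other hand, transition laws from starting points
in a bounded set have a common part of mass bounded below, because with positive probability
everything except `Ua` stays bounded (by Chebyshev's inequality, for `Ub` and for the look-ahead
point of SEG), and the positive density of `Ua` then covers a fixed ball. As in Hairer and
Mattingly's proof of Harris' theorem, drift and overlap together make the transition operator
contract the oscillation of test functions relative to `1 + β * ‖x - xs‖ ^ 2`. The contraction
bounds the mass that the laws of consecutive iterates do not share by a summable sequence, so the
limit inferior of these laws is an invariant probability measure, and the contraction gives
uniqueness and the geometric rates. Integrating the drift against the stationary law bounds the
stationary mean of `‖x - xs‖ ^ 2` and hence the bias; any solution is within `√(lam / μ)` of `xs`.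
-/

namespace StochVI

open Filter Topology

section CommonMass

variable {E F : Type*} [MeasurableSpace E] [MeasurableSpace F]

/-- `ν` and `ν'` have at least the mass `δ` in common: for finite measures this says that `ν ⊓ ν'`
has total mass at least `δ`. Stated on events, it is inherited by images and mixtures. -/
def HaveCommonMass (ν ν' : Measure E) (δ : ℝ) : Prop :=
  ∀ A, MeasurableSet A → δ ≤ ν.real A + ν'.real Aᶜ

variable {ν ν' : Measure E} {δ : ℝ}

theorem haveCommonMass_zero : HaveCommonMass ν ν' 0 := fun _ _ => by positivity

theorem HaveCommonMass.map (h : HaveCommonMass ν ν' δ) {g : E → F} (hg : Measurable g) :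
    HaveCommonMass (ν.map g) (ν'.map g) δ := fun A hA => by
  rw [map_measureReal_apply hg hA, map_measureReal_apply hg hA.compl]
  exact h _ (hg hA)

theorem HaveCommonMass.le_measureReal_inf_univ [IsFiniteMeasure ν] [IsFiniteMeasure ν']
    (h : HaveCommonMass ν ν' δ) : δ ≤ (ν ⊓ ν').real Set.univ := by
  have hfin : (ν ⊓ ν') Set.univ ≠ ∞ :=
    ((Measure.le_iff'.1 inf_le_left _).trans_lt (measure_lt_top ν _)).ne
  rw [measureReal_def, ← ENNReal.ofReal_le_iff_le_toReal hfin,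
    Measure.inf_apply MeasurableSet.univ]
  refine le_sInf ?_
  rintro _ ⟨t, rfl⟩
  have hsub : (toMeasurable ν t)ᶜ ⊆ tᶜ := Set.compl_subset_compl.2 (subset_toMeasurable ν t)
  calc ENNReal.ofReal δ
      ≤ ENNReal.ofReal (ν.real (toMeasurable ν t) + ν'.real (toMeasurable ν t)ᶜ) :=
        ENNReal.ofReal_le_ofReal (h _ (measurableSet_toMeasurable ν t))
    _ = ν (toMeasurable ν t) + ν' (toMeasurable ν t)ᶜ := by
        rw [ENNReal.ofReal_add measureReal_nonneg measureReal_nonneg, ofReal_measureReal,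
          ofReal_measureReal]
    _ ≤ ν (t ∩ Set.univ) + ν' (tᶜ ∩ Set.univ) := by
        rw [measure_toMeasurable, Set.inter_univ, Set.inter_univ]
        gcongr

theorem abs_integral_sub_integral_le_of_le {m : Measure E} (hm : m ≤ ν) {f g : E → ℝ}
    (hf : Integrable f ν) (hg : Integrable g ν) (hfg : ∀ x, |f x| ≤ g x) :
    |∫ x, f x ∂ν - ∫ x, f x ∂m| ≤ ∫ x, g x ∂ν - ∫ x, g x ∂m := by
  have hsub : ∫ x, (g x - f x) ∂m ≤ ∫ x, (g x - f x) ∂ν :=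
    integral_mono_measure hm (ae_of_all _ fun x => sub_nonneg.2 (abs_le.1 (hfg x)).2) (hg.sub hf)
  have hadd : ∫ x, (g x + f x) ∂m ≤ ∫ x, (g x + f x) ∂ν :=
    integral_mono_measure hm
      (ae_of_all _ fun x => by simpa using neg_le_iff_add_nonneg'.1 (abs_le.1 (hfg x)).1)
      (hg.add hf)
  rw [integral_sub (hg.mono_measure hm) (hf.mono_measure hm), integral_sub hg hf] at hsub
  rw [integral_add (hg.mono_measure hm) (hf.mono_measure hm), integral_add hg hf] at hadd
  rw [abs_le]
  constructor <;> linarith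

theorem HaveCommonMass.abs_integral_sub_integral_le [IsProbabilityMeasure ν]
    [IsProbabilityMeasure ν'] (h : HaveCommonMass ν ν' δ) {a : ℝ} (ha : 0 ≤ a) {f W : E → ℝ}
    (hW0 : ∀ x, 0 ≤ W x) (hW : Integrable W ν) (hW' : Integrable W ν')
    (hf : Measurable f) (hfW : ∀ x, |f x| ≤ a * (1 + W x)) :
    |∫ x, f x ∂ν - ∫ x, f x ∂ν'| ≤ a * (2 * (1 - δ) + (∫ x, W x ∂ν + ∫ x, W x ∂ν')) := by
  set m := ν ⊓ ν'
  have hbound (μ : Measure E) [IsProbabilityMeasure μ] (hm : m ≤ μ) (hWμ : Integrable W μ) :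
      |∫ x, f x ∂μ - ∫ x, f x ∂m| ≤ a * (1 - δ + ∫ x, W x ∂μ) := by
    have : IsFiniteMeasure m := isFiniteMeasure_of_le μ hm
    have hg : Integrable (fun x => a * (1 + W x)) μ := ((integrable_const 1).add hWμ).const_mul a
    have hfμ : Integrable f μ := hg.mono' hf.aestronglyMeasurable (ae_of_all _ hfW)
    refine (abs_integral_sub_integral_le_of_le hm hfμ hg hfW).trans ?_
    have hmass : δ ≤ m.real Set.univ := h.le_measureReal_inf_univ
    have hWm : 0 ≤ ∫ x, W x ∂m := integral_nonneg hW0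
    rw [integral_const_mul, integral_const_mul, ← mul_sub, integral_add (integrable_const 1) hWμ,
      integral_add (integrable_const 1) (hWμ.mono_measure hm)]
    simp only [integral_const, probReal_univ, smul_eq_mul, mul_one]
    gcongr
    linarith
  calc |∫ x, f x ∂ν - ∫ x, f x ∂ν'|
      ≤ |∫ x, f x ∂ν - ∫ x, f x ∂m| + |∫ x, f x ∂m - ∫ x, f x ∂ν'| := abs_sub_le _ _ _
    _ ≤ a * (1 - δ + ∫ x, W x ∂ν) + a * (1 - δ + ∫ x, W x ∂ν') :=
        add_le_add (hbound ν inf_le_left hW)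
          ((abs_sub_comm _ _).trans_le (hbound ν' inf_le_right hW'))
    _ = _ := by ring

end CommonMass

section WeightedOsc

variable {E : Type*} {W f : E → ℝ} {β a : ℝ}

/-- The oscillation of `f` relative to the weight `1 + β * W` is at most `2 * a`: up to an additive
constant, `f` is bounded by `a * (1 + β * W)`. -/
def WeightedOsc (W : E → ℝ) (β a : ℝ) (f : E → ℝ) : Prop :=
  ∃ c, ∀ x, |f x - c| ≤ a * (1 + β * W x)

theorem weightedOsc_of_forall_sub_le [Nonempty E]
    (h : ∀ x y, f x - f y ≤ a * (2 + β * (W x + W y))) : WeightedOsc W β a f := by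
  have hle (x y : E) : f x - a * (1 + β * W x) ≤ f y + a * (1 + β * W y) := by
    linarith [h x y]
  refine ⟨⨆ x, (f x - a * (1 + β * W x)), fun x => abs_sub_le_iff.2 ⟨?_, ?_⟩⟩
  · have hbdd : BddAbove (Set.range fun y => f y - a * (1 + β * W y)) :=
      ⟨f x + a * (1 + β * W x), Set.forall_mem_range.2 fun y => hle y x⟩
    linarith [le_ciSup hbdd x]
  · linarith [ciSup_le fun y => hle y x]

theorem weightedOsc_indicator (hW : ∀ x, 0 ≤ W x) (hβ : 0 ≤ β) (A : Set E) :
    WeightedOsc W β 1 (A.indicator 1) := by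
  refine ⟨0, fun x => ?_⟩
  have := mul_nonneg hβ (hW x)
  by_cases hx : x ∈ A <;> simp [hx] <;> linarith

variable [MeasurableSpace E] {ν ν' : Measure E}

theorem WeightedOsc.integrable [IsFiniteMeasure ν] (h : WeightedOsc W β a f) (hf : Measurable f)
    (hW : Integrable W ν) : Integrable f ν := by
  obtain ⟨c, hc⟩ := h
  have hsub : Integrable (fun x => f x - c) ν :=
    (((integrable_const 1).add (hW.const_mul β)).const_mul a).mono'
      (hf.sub_const c).aestronglyMeasurable (ae_of_all _ hc)
  exact (hsub.add (integrable_const c)).congr (ae_of_all _ fun x => sub_add_cancel (f x) c)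

theorem WeightedOsc.abs_integral_sub_integral_le [IsProbabilityMeasure ν] [IsProbabilityMeasure ν']
    (h : WeightedOsc W β a f) (hf : Measurable f) (ha : 0 ≤ a) (hβ : 0 ≤ β) (hW0 : ∀ x, 0 ≤ W x)
    (hW : Integrable W ν) (hW' : Integrable W ν') {δ : ℝ} (hδ : HaveCommonMass ν ν' δ) :
    |∫ x, f x ∂ν - ∫ x, f x ∂ν'|
      ≤ a * (2 * (1 - δ) + β * (∫ x, W x ∂ν + ∫ x, W x ∂ν')) := by
  have hν := h.integrable hf hW
  have hν' := h.integrable hf hW'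
  obtain ⟨c, hc⟩ := h
  have := hδ.abs_integral_sub_integral_le ha (fun x => mul_nonneg hβ (hW0 x)) (hW.const_mul β)
    (hW'.const_mul β) (hf.sub_const c) hc
  simpa [integral_sub, hν, hν', integral_const_mul, mul_add] using this

end WeightedOsc

section Contraction

variable {E : Type*} [MeasurableSpace E] {Q : Kernel E E} {W : E → ℝ} {κ b : ℝ}

/-- Foster–Lyapunov drift condition: one step of the chain with kernel `Q` shrinks the mean of `W`
by the factor `κ`, up to the error `b`. -/
structure GeometricDrift (Q : Kernel E E) (W : E → ℝ) (κ b : ℝ) : Prop where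
  measurable : Measurable W
  nonneg : ∀ x, 0 ≤ W x
  integrable : ∀ x, Integrable W (Q x)
  drift : ∀ x, ∫ y, W y ∂Q x ≤ κ * W x + b

/-- Any two transition laws from the same sublevel set of `W` overlap, by an amount depending only
on the level. -/
def LocallyOverlapping (Q : Kernel E E) (W : E → ℝ) : Prop :=
  ∀ r, ∃ δ, 0 < δ ∧ ∀ x y, W x ≤ r → W y ≤ r → HaveCommonMass (Q x) (Q y) δ

/-- The transition operator of `Q` shrinks weighted oscillations by the factor `ρ`. -/
def ContractsOsc (Q : Kernel E E) (W : E → ℝ) (β ρ : ℝ) : Prop :=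
  ∀ (a : ℝ) (f : E → ℝ), 0 ≤ a → Measurable f → WeightedOsc W β a f →
    WeightedOsc W β (ρ * a) fun x => ∫ y, f y ∂Q x

theorem GeometricDrift.mono (h : GeometricDrift Q W κ b) {κ' b' : ℝ} (hκ : κ ≤ κ') (hb : b ≤ b') :
    GeometricDrift Q W κ' b' :=
  { h with
    drift := fun x =>
      (h.drift x).trans (add_le_add (mul_le_mul_of_nonneg_right hκ (h.nonneg x)) hb) }

/-- With `β = δ / (2 * b)`, the rate `ρ` is the value making the second inequality an equality at
the threshold `s = 4 * b / (1 - κ)`. -/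
theorem exists_contraction_rate {δ : ℝ} (hκ0 : 0 ≤ κ) (hκ1 : κ < 1) (hb : 0 < b) (hδ : 0 < δ) :
    ∃ β ρ : ℝ, 0 < β ∧ 0 < ρ ∧ ρ < 1 ∧
      (∀ s, 0 ≤ s → 2 * (1 - δ) + β * (κ * s + 2 * b) ≤ ρ * (2 + β * s)) ∧
      ∀ s, 4 * b / (1 - κ) ≤ s → 2 + β * (κ * s + 2 * b) ≤ ρ * (2 + β * s) := by
  obtain ⟨η, rfl⟩ : ∃ η, κ = 1 - η := ⟨1 - κ, by ring⟩
  have hη : 0 < η := by linarith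
  set β := δ / (2 * b)
  have hβ : 0 < β := by positivity
  have hβb : β * (2 * b) = δ := div_mul_cancel₀ δ (by positivity)
  set t := δ * η / (2 * (η + δ))
  have ht : 0 < t := by positivity
  have ht_eq : 2 * t * (η + δ) = δ * η := by simp only [t]; field_simp
  have htδ : 2 * t ≤ δ := by nlinarith [mul_pos ht hδ]
  have htη : 2 * t ≤ η := by nlinarith [mul_pos ht hη]
  refine ⟨β, 1 - t, hβ, by linarith, by linarith, fun s hs => ?_, fun s hs => ?_⟩
  · nlinarith [mul_nonneg (mul_nonneg hβ.le hs) (by linarith : 0 ≤ η - t)]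
  · rw [sub_sub_cancel, div_le_iff₀ hη] at hs
    have hβs : 2 * δ ≤ β * s * η := by nlinarith
    have : (δ + 2 * t) * η ≤ (η - t) * (β * s) * η := by nlinarith
    nlinarith [le_of_mul_le_mul_right this hη]

theorem GeometricDrift.exists_contractsOsc [Nonempty E] [IsMarkovKernel Q]
    (h : GeometricDrift Q W κ b) (hκ0 : 0 ≤ κ) (hκ1 : κ < 1) (hb : 0 < b)
    (hQ : LocallyOverlapping Q W) :
    ∃ β ρ : ℝ, 0 < β ∧ 0 < ρ ∧ ρ < 1 ∧ ContractsOsc Q W β ρ := by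
  obtain ⟨δ, hδ, hoverlap⟩ := hQ (4 * b / (1 - κ))
  obtain ⟨β, ρ, hβ, hρ0, hρ1, hnear, hfar⟩ := exists_contraction_rate hκ0 hκ1 hb hδ
  refine ⟨β, ρ, hβ, hρ0, hρ1, fun a f ha hf hosc => weightedOsc_of_forall_sub_le fun x y => ?_⟩
  suffices hpair : ∃ δ', HaveCommonMass (Q x) (Q y) δ' ∧
      2 * (1 - δ') + β * (κ * (W x + W y) + 2 * b) ≤ ρ * (2 + β * (W x + W y)) by
    obtain ⟨δ', hδ', hle⟩ := hpair
    calc ∫ z, f z ∂Q x - ∫ z, f z ∂Q y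
        ≤ a * (2 * (1 - δ') + β * (∫ z, W z ∂Q x + ∫ z, W z ∂Q y)) :=
          (le_abs_self _).trans (hosc.abs_integral_sub_integral_le hf ha hβ.le h.nonneg
            (h.integrable x) (h.integrable y) hδ')
      _ ≤ a * (2 * (1 - δ') + β * (κ * (W x + W y) + 2 * b)) := by
          gcongr a * (2 * (1 - δ') + β * ?_)
          linarith [h.drift x, h.drift y]
      _ ≤ a * (ρ * (2 + β * (W x + W y))) := by gcongr
      _ = ρ * a * (2 + β * (W x + W y)) := by ring
  have hx := h.nonneg x
  have hy := h.nonneg y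
  rcases le_total (W x + W y) (4 * b / (1 - κ)) with hle | hge
  · exact ⟨δ, hoverlap x y (by linarith) (by linarith), hnear _ (by positivity)⟩
  · exact ⟨0, haveCommonMass_zero, by simpa using hfar _ hge⟩

end Contraction

section LiminfMeasure

variable {E : Type*} [MeasurableSpace E] {ν : ℕ → Measure E}

theorem iSup_measure_apply_of_monotone (hν : Monotone ν) {s : Set E} (hs : MeasurableSet s) :
    (⨆ n, ν n) s = ⨆ n, ν n s := by
  let m : Measure E := Measure.ofMeasurable (fun s _ => ⨆ n, ν n s) (by simp) fun A hA hd => by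
    simp only [measure_iUnion hd hA, ENNReal.tsum_eq_iSup_sum]
    rw [iSup_comm]
    exact iSup_congr fun t =>
      (ENNReal.finsetSum_iSup_of_monotone fun i n k hnk => hν hnk (A i)).symm
  have hm {s : Set E} (hs : MeasurableSet s) : m s = ⨆ n, ν n s := Measure.ofMeasurable_apply s hs
  have hle : ⨆ n, ν n ≤ m :=
    iSup_le fun n => Measure.le_iff.2 fun s hs => (le_iSup (fun n => ν n s) n).trans_eq (hm hs).symm
  exact le_antisymm ((hle s).trans_eq (hm hs)) (iSup_le fun n => le_iSup ν n s)

theorem lintegral_iSup_measure_of_monotone (hν : Monotone ν) {f : E → ℝ≥0∞} (hf : Measurable f) :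
    ∫⁻ x, f x ∂(⨆ n, ν n) = ⨆ n, ∫⁻ x, f x ∂ν n := by
  refine hf.ennreal_induction (fun c s hs => ?_) (fun f g _ hf _ ihf ihg => ?_)
    fun f hf hmono ih => ?_
  · simp only [lintegral_indicator hs, setLIntegral_const, iSup_measure_apply_of_monotone hν hs,
      ENNReal.mul_iSup]
  · simp only [Pi.add_apply, lintegral_add_left hf, ihf, ihg]
    exact ENNReal.iSup_add_iSup_of_monotone (fun n k hnk => lintegral_mono' (hν hnk) le_rfl)
      fun n k hnk => lintegral_mono' (hν hnk) le_rfl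
  · simp only [lintegral_iSup hf hmono, ih]
    exact iSup_comm

theorem lintegral_liminf_measure_eq_iSup {f : E → ℝ≥0∞} (hf : Measurable f) :
    ∫⁻ x, f x ∂(liminf ν atTop) = ⨆ N, ∫⁻ x, f x ∂(⨅ k, ν (k + N)) := by
  rw [liminf_eq_iSup_iInf_of_nat']
  refine lintegral_iSup_measure_of_monotone (monotone_nat_of_le_succ fun N => ?_) hf
  refine le_iInf fun k => (iInf_le _ (k + 1)).trans_eq ?_
  rw [Nat.add_right_comm, Nat.add_assoc]

theorem lintegral_liminf_measure_le {f : E → ℝ≥0∞} (hf : Measurable f) :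
    ∫⁻ x, f x ∂(liminf ν atTop) ≤ liminf (fun n => ∫⁻ x, f x ∂ν n) atTop := by
  rw [lintegral_liminf_measure_eq_iSup hf, liminf_eq_iSup_iInf_of_nat']
  exact iSup_mono fun N => le_iInf fun k => lintegral_mono' (iInf_le _ k) le_rfl

theorem liminf_measure_bind_le (ν : ℕ → Measure E) (Q : Kernel E E) :
    (liminf ν atTop).bind Q ≤ liminf (fun n => (ν n).bind Q) atTop := by
  refine Measure.le_iff.2 fun A hA => ?_
  rw [Measure.bind_apply hA Q.aemeasurable,
    lintegral_liminf_measure_eq_iSup (Q.measurable_coe hA), liminf_eq_iSup_iInf_of_nat']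
  refine iSup_le fun N => ?_
  rw [← Measure.bind_apply hA Q.aemeasurable]
  refine (le_iInf fun k => Measure.le_iff.2 fun B hB => ?_ :
    (⨅ k, ν (k + N)).bind Q ≤ ⨅ k, (ν (k + N)).bind Q).trans
      (le_iSup (fun N => ⨅ k, (ν (k + N)).bind Q) N) A
  rw [Measure.bind_apply hB Q.aemeasurable, Measure.bind_apply hB Q.aemeasurable]
  exact lintegral_mono' (iInf_le _ k) le_rfl

theorem HaveCommonMass.sub_apply_univ_le {ν ν' : Measure E} [IsProbabilityMeasure ν]
    [IsProbabilityMeasure ν'] {δ : ℝ} (h : HaveCommonMass ν ν' δ) :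
    (ν - ν') Set.univ ≤ ENNReal.ofReal (1 - δ) := by
  have hfin : IsFiniteMeasure (ν ⊓ ν') := isFiniteMeasure_of_le ν inf_le_left
  have hsub : ν - ν' ≤ ν - (ν ⊓ ν') := by
    refine Measure.sub_le_of_le_add ?_
    conv_lhs => rw [← Measure.sub_add_cancel_of_le (inf_le_left : ν ⊓ ν' ≤ ν)]
    gcongr
    exact inf_le_right
  calc (ν - ν') Set.univ ≤ (ν - (ν ⊓ ν')) Set.univ := hsub _
    _ = ENNReal.ofReal 1 - ENNReal.ofReal ((ν ⊓ ν').real Set.univ) := by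
        rw [Measure.sub_apply MeasurableSet.univ inf_le_left, measure_univ, ENNReal.ofReal_one,
          ofReal_measureReal]
    _ = ENNReal.ofReal (1 - (ν ⊓ ν').real Set.univ) :=
        (ENNReal.ofReal_sub _ measureReal_nonneg).symm
    _ ≤ ENNReal.ofReal (1 - δ) := by
        gcongr
        exact h.le_measureReal_inf_univ

theorem le_add_sum_range_sub [∀ n, IsFiniteMeasure (ν n)] (k : ℕ) :
    ν 0 ≤ ν k + ∑ i ∈ Finset.range k, (ν i - ν (i + 1)) := by
  induction k with
  | zero => simp
  | succ k ih =>
    rw [Finset.sum_range_succ, add_comm (∑ i ∈ Finset.range k, _), ← add_assoc,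
      add_comm (ν (k + 1))]
    exact ih.trans (by gcongr; exact Measure.sub_le_iff_le_add.1 le_rfl)

theorem measure_univ_le_iInf_add_tsum [∀ n, IsFiniteMeasure (ν n)] {ε : ℕ → ℝ≥0∞}
    (hε : ∑' n, ε n ≠ ∞) (hν : ∀ n, (ν n - ν (n + 1)) Set.univ ≤ ε n) :
    ν 0 Set.univ ≤ (⨅ k, ν k) Set.univ + ∑' n, ε n := by
  set excess := Measure.sum fun n => ν n - ν (n + 1)
  have hmass : excess Set.univ ≤ ∑' n, ε n := by
    rw [Measure.sum_apply _ MeasurableSet.univ]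
    exact ENNReal.tsum_le_tsum hν
  have : IsFiniteMeasure excess := ⟨hmass.trans_lt hε.lt_top⟩
  have hsum (k : ℕ) : ∑ i ∈ Finset.range k, (ν i - ν (i + 1)) ≤ excess :=
    Measure.le_iff.2 fun A hA => by
      rw [Measure.finsetSum_apply, Measure.sum_apply _ hA]
      exact ENNReal.sum_le_tsum _
  have hle : ν 0 - excess ≤ ⨅ k, ν k := le_iInf fun k =>
    Measure.sub_le_of_le_add ((le_add_sum_range_sub k).trans (by gcongr; exact hsum k))
  calc ν 0 Set.univ ≤ (ν 0 - excess) Set.univ + excess Set.univ :=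
        Measure.sub_le_iff_le_add.1 le_rfl _
    _ ≤ (⨅ k, ν k) Set.univ + ∑' n, ε n := add_le_add (hle _) hmass

theorem isProbabilityMeasure_liminf_measure [∀ n, IsProbabilityMeasure (ν n)] {ε : ℕ → ℝ≥0∞}
    (hε : ∑' n, ε n ≠ ∞) (hν : ∀ n, (ν n - ν (n + 1)) Set.univ ≤ ε n) :
    IsProbabilityMeasure (liminf ν atTop) := by
  have hmass : (liminf ν atTop) Set.univ = ⨆ N, (⨅ k, ν (k + N)) Set.univ := by
    simpa using lintegral_liminf_measure_eq_iSup (ν := ν) (measurable_const (a := 1))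
  refine ⟨le_antisymm ?_ ?_⟩
  · rw [hmass]
    exact iSup_le fun N => (iInf_le (fun k => ν (k + N)) 0 Set.univ).trans_eq measure_univ
  · have htail (N : ℕ) : 1 ≤ (liminf ν atTop) Set.univ + ∑' k, ε (k + N) := by
      have hεN : ∑' k, ε (k + N) ≠ ∞ :=
        ne_top_of_le_ne_top hε (ENNReal.tsum_comp_le_tsum_of_injective (add_left_injective N) ε)
      have := measure_univ_le_iInf_add_tsum (ν := fun k => ν (k + N)) hεN fun k => by
        simpa only [Nat.add_right_comm] using hν (k + N)
      rw [measure_univ] at this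
      refine this.trans ?_
      rw [hmass]
      gcongr
      exact le_iSup (fun N => (⨅ k, ν (k + N)) Set.univ) N
    have hlim := (ENNReal.tendsto_sum_nat_add ε hε).const_add ((liminf ν atTop) Set.univ)
    rw [add_zero] at hlim
    exact ge_of_tendsto' hlim htail

end LiminfMeasure

section Evolution

variable {E F : Type*} [MeasurableSpace E] [MeasurableSpace F]

theorem integral_bind_kernel {Q : Kernel E F} {ν : Measure E} {f : F → ℝ}
    (hf : Integrable f (ν.bind Q)) : ∫ y, f y ∂(ν.bind Q) = ∫ x, ∫ y, f y ∂Q x ∂ν := by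
  rw [Measure.comp_eq_comp_const_apply] at hf ⊢
  rw [Kernel.integral_comp hf, Kernel.const_apply]

theorem integrable_bind_of_integral_le {Q : Kernel E F} {ν : Measure E} {W : F → ℝ} {h : E → ℝ}
    (hWm : Measurable W) (hW0 : ∀ y, 0 ≤ W y) (hW : ∀ x, Integrable W (Q x))
    (hh : Integrable h ν) (hle : ∀ x, ∫ y, W y ∂Q x ≤ h x) :
    Integrable W (ν.bind Q) ∧ ∫ y, W y ∂(ν.bind Q) ≤ ∫ x, h x ∂ν := by
  have hnorm (x : E) : ∫ y, ‖W y‖ ∂Q x = ∫ y, W y ∂Q x :=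
    integral_congr_ae (ae_of_all _ fun y => Real.norm_of_nonneg (hW0 y))
  have hint : Integrable (fun x => ∫ y, W y ∂Q x) ν :=
    hh.mono' hWm.stronglyMeasurable.integral_kernel.aestronglyMeasurable
      (ae_of_all _ fun x => (Real.norm_of_nonneg (integral_nonneg hW0)).trans_le (hle x))
  have hbind : Integrable W (ν.bind Q) := by
    rw [Measure.integrable_comp_iff hWm.aestronglyMeasurable]
    exact ⟨ae_of_all _ hW, by simpa only [hnorm] using hint⟩
  exact ⟨hbind, (integral_bind_kernel hbind).trans_le (integral_mono hint hh hle)⟩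

variable {Q : Kernel E E} {W : E → ℝ} {κ b : ℝ}

theorem pow_zero_apply_eq_dirac (Q : Kernel E E) (x : E) : (Q ^ 0) x = Measure.dirac x :=
  Kernel.id_apply x

theorem pow_succ_apply_eq_bind (Q : Kernel E E) (n : ℕ) (x : E) :
    (Q ^ (n + 1)) x = ((Q ^ n) x).bind Q := by
  rw [pow_succ']
  exact Kernel.comp_apply Q (Q ^ n) x

theorem pow_succ_apply_eq_bind_pow (Q : Kernel E E) (n : ℕ) (x : E) :
    (Q ^ (n + 1)) x = (Q x).bind ⇑(Q ^ n) := by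
  rw [pow_succ]
  exact Kernel.comp_apply (Q ^ n) Q x

instance isMarkovKernel_pow [IsMarkovKernel Q] (n : ℕ) : IsMarkovKernel (Q ^ n) := by
  induction n with
  | zero => exact inferInstanceAs (IsMarkovKernel Kernel.id)
  | succ n ih =>
    rw [pow_succ]
    exact inferInstanceAs (IsMarkovKernel ((Q ^ n) ∘ₖ Q))

theorem invariant_pow {π : Measure E} (hπ : Q.Invariant π) (n : ℕ) : (Q ^ n).Invariant π := by
  induction n with
  | zero => exact Measure.bind_dirac
  | succ n ih =>
    rw [pow_succ]
    exact ih.comp hπ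

theorem GeometricDrift.integrable_bind (h : GeometricDrift Q W κ b) {ν : Measure E}
    [IsFiniteMeasure ν] (hW : Integrable W ν) : Integrable W (ν.bind Q) :=
  (integrable_bind_of_integral_le h.measurable h.nonneg h.integrable
    ((hW.const_mul κ).add (integrable_const b)) h.drift).1

theorem GeometricDrift.integral_bind_le (h : GeometricDrift Q W κ b) {ν : Measure E}
    [IsProbabilityMeasure ν] (hW : Integrable W ν) :
    ∫ y, W y ∂(ν.bind Q) ≤ κ * ∫ x, W x ∂ν + b := by
  refine (integrable_bind_of_integral_le h.measurable h.nonneg h.integrable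
    ((hW.const_mul κ).add (integrable_const b)) h.drift).2.trans_eq ?_
  simp [integral_add, hW.const_mul κ, integral_const_mul]

theorem GeometricDrift.pow [IsMarkovKernel Q] (h : GeometricDrift Q W κ b) (hκ0 : 0 ≤ κ)
    (hκ1 : κ < 1) (hb : 0 ≤ b) (n : ℕ) : GeometricDrift (Q ^ n) W 1 (b / (1 - κ)) := by
  have hκ : 0 < 1 - κ := sub_pos.2 hκ1
  set B := b / (1 - κ)
  have hB : B * (1 - κ) = b := div_mul_cancel₀ b hκ.ne'
  suffices hn : ∀ x, Integrable W ((Q ^ n) x) ∧ ∫ y, W y ∂(Q ^ n) x ≤ W x + B from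
    ⟨h.measurable, h.nonneg, fun x => (hn x).1, fun x => by simpa using (hn x).2⟩
  intro x
  induction n with
  | zero =>
    rw [pow_zero_apply_eq_dirac]
    refine ⟨integrable_dirac' h.measurable.stronglyMeasurable (by simp), ?_⟩
    rw [integral_dirac' _ _ h.measurable.stronglyMeasurable]
    linarith [div_nonneg hb hκ.le]
  | succ n ih =>
    rw [pow_succ_apply_eq_bind]
    refine ⟨h.integrable_bind ih.1, (h.integral_bind_le ih.1).trans ?_⟩
    nlinarith [mul_le_mul_of_nonneg_left ih.2 hκ0, mul_nonneg hκ.le (h.nonneg x)]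

theorem ContractsOsc.pow [IsMarkovKernel Q] {β ρ : ℝ} (hQ : ContractsOsc Q W β ρ) (hρ : 0 ≤ ρ)
    (hW : ∀ n x, Integrable W ((Q ^ n) x)) (n : ℕ) : ContractsOsc (Q ^ n) W β (ρ ^ n) := by
  intro a f ha hf hosc
  induction n with
  | zero =>
    rw [pow_zero ρ, one_mul]
    simpa only [pow_zero_apply_eq_dirac, integral_dirac' _ _ hf.stronglyMeasurable] using hosc
  | succ n ih =>
    have hstep (x : E) : ∫ y, f y ∂(Q ^ (n + 1)) x = ∫ z, ∫ y, f y ∂(Q ^ n) z ∂Q x := by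
      have hint := hosc.integrable hf (hW (n + 1) x)
      rw [pow_succ_apply_eq_bind_pow] at hint ⊢
      exact integral_bind_kernel hint
    simp only [hstep]
    rw [pow_succ' ρ, mul_assoc]
    exact hQ _ _ (by positivity) hf.stronglyMeasurable.integral_kernel.measurable ih

variable [IsMarkovKernel Q]

theorem ContractsOsc.abs_integral_bind_sub_le {β ρ : ℝ} (hQ : ContractsOsc Q W β ρ)
    (hρ : 0 ≤ ρ) (hβ : 0 ≤ β) (h : GeometricDrift Q W κ b) {ν ν' : Measure E}
    [IsProbabilityMeasure ν] [IsProbabilityMeasure ν'] (hW : Integrable W ν)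
    (hW' : Integrable W ν') {a : ℝ} (ha : 0 ≤ a) {f : E → ℝ} (hf : Measurable f)
    (hosc : WeightedOsc W β a f) :
    |∫ y, f y ∂ν.bind Q - ∫ y, f y ∂ν'.bind Q|
      ≤ ρ * (a * (2 + β * (∫ x, W x ∂ν + ∫ x, W x ∂ν'))) := by
  rw [integral_bind_kernel (hosc.integrable hf (h.integrable_bind hW)),
    integral_bind_kernel (hosc.integrable hf (h.integrable_bind hW'))]
  simpa [mul_assoc] using (hQ a f ha hf hosc).abs_integral_sub_integral_le
    hf.stronglyMeasurable.integral_kernel.measurable (by positivity) hβ h.nonneg hW hW'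
    haveCommonMass_zero

end Evolution

section Harris

variable {E : Type*} [MeasurableSpace E] {Q : Kernel E E} {W : E → ℝ} {κ b : ℝ}

/-- The chain with kernel `Q` converges geometrically to its unique stationary distribution `π`,
uniformly over functions of bounded oscillation relative to a weight `1 + β * W`. -/
structure GeometricallyErgodic (Q : Kernel E E) (W : E → ℝ) (π : Measure E) : Prop where
  prob : IsProbabilityMeasure π
  invariant : Q.Invariant π
  unique : ∀ π' : Measure E, IsProbabilityMeasure π' → Q.Invariant π' → π' = π
  integrable : Integrable W π
  converges : ∃ β ρ : ℝ, 0 < β ∧ 0 < ρ ∧ ρ < 1 ∧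
    ∀ (a : ℝ) (f : E → ℝ), 0 ≤ a → Measurable f → WeightedOsc W β a f → ∀ (x : E) (n : ℕ),
      |∫ y, f y ∂(Q ^ n) x - ∫ y, f y ∂π| ≤ a * (2 + β * (W x + ∫ y, W y ∂π)) * ρ ^ n

theorem dirac_bind_pow (Q : Kernel E E) (n : ℕ) (x : E) :
    (Measure.dirac x).bind ⇑(Q ^ n) = (Q ^ n) x :=
  Measure.dirac_bind (Q ^ n).measurable x

variable [IsMarkovKernel Q]

theorem haveCommonMass_pow_succ (h : GeometricDrift Q W κ b) (hκ0 : 0 ≤ κ) (hκ1 : κ < 1)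
    (hb : 0 ≤ b) {β ρ : ℝ} (hβ : 0 ≤ β) (hρ : 0 ≤ ρ) (hQ : ContractsOsc Q W β ρ) (x : E) (n : ℕ) :
    HaveCommonMass ((Q ^ n) x) ((Q ^ (n + 1)) x)
      (1 - (2 + β * (W x + ∫ y, W y ∂Q x)) * ρ ^ n) := by
  have hpow := h.pow hκ0 hκ1 hb
  have hW : Integrable W (Measure.dirac x) :=
    integrable_dirac' h.measurable.stronglyMeasurable (by simp)
  intro A hA
  have hdiff := (hQ.pow hρ (fun n => (hpow n).integrable) n).abs_integral_bind_sub_le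
    (pow_nonneg hρ n) hβ (hpow n) hW (h.integrable x) zero_le_one
    ((measurable_const (a := (1 : ℝ))).indicator hA) (weightedOsc_indicator h.nonneg hβ A)
  rw [dirac_bind_pow, ← pow_succ_apply_eq_bind_pow, integral_dirac' _ _
    h.measurable.stronglyMeasurable] at hdiff
  simp only [integral_indicator_const _ hA, smul_eq_mul, mul_one, one_mul] at hdiff
  rw [probReal_compl_eq_one_sub hA]
  linarith [(abs_le.1 hdiff).1]

theorem exists_invariant_of_tsum_ne_top {x : E} {ε : ℕ → ℝ≥0∞} (hε : ∑' n, ε n ≠ ∞)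
    (hx : ∀ n, ((Q ^ n) x - (Q ^ (n + 1)) x) Set.univ ≤ ε n) :
    IsProbabilityMeasure (liminf (fun n => (Q ^ n) x) atTop) ∧
      Q.Invariant (liminf (fun n => (Q ^ n) x) atTop) := by
  have hprob := isProbabilityMeasure_liminf_measure hε hx
  have hle :=
    calc (liminf (fun n => (Q ^ n) x) atTop).bind Q
        ≤ liminf (fun n => ((Q ^ n) x).bind Q) atTop := liminf_measure_bind_le _ Q
      _ = liminf (fun n => (Q ^ (n + 1)) x) atTop := by simp only [pow_succ_apply_eq_bind]
      _ = liminf (fun n => (Q ^ n) x) atTop :=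
          liminf_nat_add (fun n => (Q ^ n) x) 1
  generalize liminf (fun n => (Q ^ n) x) atTop = π at hprob hle ⊢
  exact ⟨hprob, Measure.eq_of_le_of_measure_univ_eq hle (measure_univ.trans measure_univ.symm)⟩

theorem integrable_liminf_pow (h : GeometricDrift Q W κ b) (hκ0 : 0 ≤ κ) (hκ1 : κ < 1)
    (hb : 0 ≤ b) (x : E) : Integrable W (liminf (fun n => (Q ^ n) x) atTop) := by
  have hpow := h.pow hκ0 hκ1 hb
  refine ⟨h.measurable.aestronglyMeasurable, ?_⟩
  rw [hasFiniteIntegral_iff_ofReal (ae_of_all _ h.nonneg)]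
  refine (lintegral_liminf_measure_le h.measurable.ennreal_ofReal).trans_lt ?_
  refine (liminf_le_of_le (a := ENNReal.ofReal (1 * W x + b / (1 - κ)))
    (by isBoundedDefault) fun c hc => ?_).trans_lt ENNReal.ofReal_lt_top
  obtain ⟨n, hn⟩ := hc.exists
  refine hn.trans ?_
  rw [← ofReal_integral_eq_lintegral_ofReal ((hpow n).integrable x) (ae_of_all _ h.nonneg)]
  exact ENNReal.ofReal_le_ofReal ((hpow n).drift x)

theorem eq_of_invariant_of_tendsto {π π' : Measure E} [IsFiniteMeasure π] [IsProbabilityMeasure π']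
    (hπ' : Q.Invariant π')
    (h : ∀ A, MeasurableSet A → ∀ x, Tendsto (fun n => ((Q ^ n) x).real A) atTop (𝓝 (π.real A))) :
    π' = π := by
  refine Measure.ext fun A hA => (measureReal_eq_measureReal_iff).1 ?_
  have hstat (n : ℕ) : ∫ x, ((Q ^ n) x).real A ∂π' = π'.real A := by
    conv_rhs => rw [← (invariant_pow hπ' n).def, measureReal_def,
      Measure.bind_apply hA (Q ^ n).aemeasurable]
    exact integral_toReal ((Q ^ n).measurable_coe hA).aemeasurable
      (ae_of_all _ fun x => measure_lt_top _ _)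
  have hlim := tendsto_integral_of_dominated_convergence (μ := π')
    (F := fun n x => ((Q ^ n) x).real A) (fun _ => (1 : ℝ))
    (fun n => ((Q ^ n).measurable_coe hA).ennreal_toReal.aestronglyMeasurable)
    (integrable_const 1)
    (fun n => ae_of_all _ fun x => by
      rw [Real.norm_of_nonneg measureReal_nonneg]
      exact measureReal_le_one)
    (ae_of_all _ (h A hA))
  simp only [hstat, integral_const, probReal_univ, one_smul] at hlim
  exact tendsto_nhds_unique tendsto_const_nhds hlim

theorem ContractsOsc.abs_integral_pow_sub_le (h : GeometricDrift Q W κ b) (hκ0 : 0 ≤ κ)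
    (hκ1 : κ < 1) (hb : 0 ≤ b) {β ρ : ℝ} (hβ : 0 ≤ β) (hρ : 0 ≤ ρ) (hQ : ContractsOsc Q W β ρ)
    {π : Measure E} [IsProbabilityMeasure π] (hπ : Q.Invariant π) (hWπ : Integrable W π)
    {a : ℝ} (ha : 0 ≤ a) {f : E → ℝ} (hf : Measurable f) (hosc : WeightedOsc W β a f)
    (x : E) (n : ℕ) :
    |∫ y, f y ∂(Q ^ n) x - ∫ y, f y ∂π| ≤ a * (2 + β * (W x + ∫ y, W y ∂π)) * ρ ^ n := by
  have hpow := h.pow hκ0 hκ1 hb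
  have hW : Integrable W (Measure.dirac x) :=
    integrable_dirac' h.measurable.stronglyMeasurable (by simp)
  have := (hQ.pow hρ (fun n => (hpow n).integrable) n).abs_integral_bind_sub_le
    (pow_nonneg hρ n) hβ (hpow n) hW hWπ ha hf hosc
  rwa [dirac_bind_pow, (invariant_pow hπ n).def, integral_dirac' _ _
    h.measurable.stronglyMeasurable, mul_comm] at this

theorem GeometricDrift.exists_geometricallyErgodic [Nonempty E] (h : GeometricDrift Q W κ b)
    (hκ0 : 0 ≤ κ) (hκ1 : κ < 1) (hb : 0 < b) (hQ : LocallyOverlapping Q W) :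
    ∃ π : Measure E, GeometricallyErgodic Q W π := by
  obtain ⟨β, ρ, hβ, hρ0, hρ1, hcontr⟩ := h.exists_contractsOsc hκ0 hκ1 hb hQ
  obtain ⟨x⟩ := ‹Nonempty E›
  have hsummable : Summable fun n => (2 + β * (W x + ∫ y, W y ∂Q x)) * ρ ^ n :=
    (summable_geometric_of_lt_one hρ0.le hρ1).mul_left _
  obtain ⟨hprob, hinv⟩ := exists_invariant_of_tsum_ne_top (Q := Q) (x := x)
    hsummable.tsum_ofReal_ne_top fun n => by
      simpa only [sub_sub_cancel] using
        (haveCommonMass_pow_succ h hκ0 hκ1 hb.le hβ.le hρ0.le hcontr x n).sub_apply_univ_le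
  have hint := integrable_liminf_pow h hκ0 hκ1 hb.le x
  have hconv {a : ℝ} {f : E → ℝ} (ha : 0 ≤ a) (hf : Measurable f) (hosc : WeightedOsc W β a f) :=
    hcontr.abs_integral_pow_sub_le h hκ0 hκ1 hb.le hβ.le hρ0.le hinv hint ha hf hosc
  refine ⟨_, hprob, hinv, fun π' _ hπ' => eq_of_invariant_of_tendsto hπ' fun A hA y => ?_, hint,
    β, ρ, hβ, hρ0, hρ1, fun a f ha hf hosc => hconv ha hf hosc⟩
  have hbound (n : ℕ) := hconv zero_le_one ((measurable_const (a := (1 : ℝ))).indicator hA)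
    (weightedOsc_indicator h.nonneg hβ.le A) y n
  simp only [integral_indicator_const _ hA, smul_eq_mul, mul_one] at hbound
  refine tendsto_iff_dist_tendsto_zero.2 (squeeze_zero (fun _ => dist_nonneg) hbound ?_)
  simpa using (tendsto_pow_atTop_nhds_zero_of_lt_one hρ0.le hρ1).const_mul
    (1 * (2 + β * (W y + ∫ z, W z ∂liminf (fun n => (Q ^ n) x) atTop)))

end Harris

section Mixture

variable {E F : Type*} [MeasurableSpace E] [MeasurableSpace F]

theorem exists_mul_measureReal_le_bind {ν : Measure E} [IsFiniteMeasure ν] {K : Kernel E F}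
    [IsMarkovKernel K] {s : Set E} (hs : ν s ≠ 0) {A : Set F} (hA : MeasurableSet A) :
    ∃ x ∈ s, ν.real s * (K x).real A ≤ (ν.bind K).real A := by
  obtain ⟨x, hx, hle⟩ := exists_le_setLAverage hs (measure_ne_top ν s)
    (K.measurable_coe hA).aemeasurable
  refine ⟨x, hx, ?_⟩
  rw [setLAverage_eq, ENNReal.le_div_iff_mul_le (.inl hs) (.inl (measure_ne_top ν s))] at hle
  rw [measureReal_def, measureReal_def, measureReal_def, ← ENNReal.toReal_mul, mul_comm]
  refine ENNReal.toReal_mono (measure_ne_top _ _) (hle.trans ?_)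
  rw [Measure.bind_apply hA K.aemeasurable]
  exact setLIntegral_le_lintegral s _

theorem HaveCommonMass.bind {ν ν' : Measure E} [IsFiniteMeasure ν] [IsFiniteMeasure ν']
    {K K' : Kernel E F} [IsMarkovKernel K] [IsMarkovKernel K'] {s s' : Set E} {m δ : ℝ}
    (hm : 0 < m) (hs : m ≤ ν.real s) (hs' : m ≤ ν'.real s')
    (h : ∀ x ∈ s, ∀ y ∈ s', HaveCommonMass (K x) (K' y) δ) :
    HaveCommonMass (ν.bind K) (ν'.bind K') (m * δ) := by
  intro A hA
  have hne {μ : Measure E} {t : Set E} (ht : m ≤ μ.real t) : μ t ≠ 0 := fun h0 => by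
    simp [measureReal_def, h0] at ht
    linarith
  obtain ⟨x, hx, hxA⟩ := exists_mul_measureReal_le_bind (K := K) (hne hs) hA
  obtain ⟨y, hy, hyA⟩ := exists_mul_measureReal_le_bind (K := K') (hne hs') hA.compl
  calc m * δ ≤ m * (K x).real A + m * (K' y).real Aᶜ := by
        rw [← mul_add]
        gcongr
        exact h x hx y hy A hA
    _ ≤ (ν.bind K).real A + (ν'.bind K').real Aᶜ :=
        add_le_add ((by gcongr : _ ≤ _).trans hxA) ((by gcongr : _ ≤ _).trans hyA)

end Mixture

section Freezing

theorem measurable_eval {Ω E F : Type*} [mE : MeasurableSpace E] [MeasurableSpace F]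
    {m m₂ : MeasurableSpace Ω} (h : m₂ ≤ m) {Z : Ω → E} (hZ : Measurable[m] Z) {g : E × Ω → F}
    (hg : Measurable[MeasurableSpace.prod mE m₂] g) : Measurable[m] fun ω => g (Z ω, ω) :=
  hg.comp (hZ.prodMk (measurable_id'' h))

theorem measurable_of_measurable_prod {Ω E F : Type*} [mE : MeasurableSpace E] [MeasurableSpace F]
    {m m₂ : MeasurableSpace Ω} (h : m₂ ≤ m) {g : E × Ω → F}
    (hg : Measurable[MeasurableSpace.prod mE m₂] g) : Measurable[MeasurableSpace.prod mE m] g :=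
  hg.mono (sup_le_sup le_rfl (MeasurableSpace.comap_mono h)) le_rfl

variable {Ω : Type*} {m₁ m₂ : MeasurableSpace Ω} [mΩ : MeasurableSpace Ω] {P : Measure Ω}
  [IsProbabilityMeasure P]

theorem lintegral_comp_of_indepFun {E Ω' : Type*} [MeasurableSpace E] [MeasurableSpace Ω']
    {Z : Ω → E} {T : Ω → Ω'} (hZ : Measurable Z) (hT : Measurable T) (hind : IndepFun Z T P)
    {g : E × Ω' → ℝ≥0∞} (hg : Measurable g) :
    ∫⁻ ω, g (Z ω, T ω) ∂P = ∫⁻ z, ∫⁻ ω, g (z, T ω) ∂P ∂(P.map Z) := by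
  have : IsProbabilityMeasure (P.map T) := Measure.isProbabilityMeasure_map hT.aemeasurable
  rw [← lintegral_map hg (hZ.prodMk hT),
    (indepFun_iff_map_prod_eq_prod_map_map hZ.aemeasurable hT.aemeasurable).1 hind,
    lintegral_prod _ hg.aemeasurable]
  exact lintegral_congr fun z => lintegral_map (hg.comp measurable_prodMk_left) hT

theorem lintegral_eval_of_indep {E : Type*} [mE : MeasurableSpace E] (h₁ : m₁ ≤ mΩ) (h₂ : m₂ ≤ mΩ)
    (hind : Indep m₁ m₂ P) {Z : Ω → E} (hZ : Measurable[m₁] Z) {g : E × Ω → ℝ≥0∞}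
    (hg : Measurable[MeasurableSpace.prod mE m₂] g) :
    ∫⁻ ω, g (Z ω, ω) ∂P = ∫⁻ z, ∫⁻ ω, g (z, ω) ∂P ∂(P.map Z) := by
  have hindep : Indep (MeasurableSpace.comap Z mE) (MeasurableSpace.comap id m₂) P := by
    rw [MeasurableSpace.comap_id]
    exact indep_of_indep_of_le_left hind hZ.comap_le
  exact @lintegral_comp_of_indepFun Ω mΩ P _ E Ω mE m₂ Z id (hZ.mono h₁ le_rfl)
    (measurable_id'' h₂) hindep g hg

variable {d : ℕ}

theorem updateKernel_apply {F : Vec d → Ω → Vec d} (hF : Measurable fun q : Vec d × Ω => F q.1 q.2)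
    (x : Vec d) : updateKernel P F x = P.map (F x) := by
  rw [updateKernel, Kernel.map_apply _ hF, Kernel.prod_apply, Kernel.id_apply, Kernel.const_apply,
    Measure.dirac_prod, Measure.map_map hF measurable_prodMk_left]
  rfl

theorem isMarkovKernel_updateKernel {F : Vec d → Ω → Vec d}
    (hF : Measurable fun q : Vec d × Ω => F q.1 q.2) : IsMarkovKernel (updateKernel P F) :=
  Kernel.IsMarkovKernel.map _ hF

theorem map_eval_eq_bind_updateKernel (h₁ : m₁ ≤ mΩ) (h₂ : m₂ ≤ mΩ) (hind : Indep m₁ m₂ P)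
    {Z : Ω → Vec d} (hZ : Measurable[m₁] Z) {F : Vec d → Ω → Vec d}
    (hF : Measurable[MeasurableSpace.prod inferInstance m₂] fun q : Vec d × Ω => F q.1 q.2) :
    P.map (fun ω => F (Z ω) ω) = (P.map Z).bind (updateKernel P F) := by
  have hFΩ := measurable_of_measurable_prod h₂ hF
  have hlaw {X : Ω → Vec d} (hX : Measurable X) {A : Set (Vec d)} (hA : MeasurableSet A) :
      ∫⁻ ω, A.indicator (1 : Vec d → ℝ≥0∞) (X ω) ∂P = P.map X A := by
    rw [← lintegral_map (measurable_one.indicator hA) hX, lintegral_indicator_one hA]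
  ext A hA
  have hfreeze := lintegral_eval_of_indep h₁ h₂ hind hZ
    ((measurable_one.indicator hA : Measurable (A.indicator (1 : Vec d → ℝ≥0∞))).comp hF)
  rw [Measure.bind_apply hA (Kernel.aemeasurable _),
    ← hlaw (measurable_eval h₂ (hZ.mono h₁ le_rfl) hF) hA]
  refine hfreeze.trans (lintegral_congr fun z => ?_)
  rw [updateKernel_apply hFΩ]
  exact hlaw (hFΩ.comp measurable_prodMk_left) hA

theorem measurable_and_map_eq_pow {𝒜 : ℕ → MeasurableSpace Ω} (hle : ∀ n, 𝒜 n ≤ mΩ)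
    (hind : ∀ n, Indep (⨆ k ∈ Set.Iio n, 𝒜 k) (𝒜 n) P) {F : ℕ → Vec d → Ω → Vec d}
    (hF : ∀ n, Measurable[MeasurableSpace.prod inferInstance (𝒜 n)]
      fun q : Vec d × Ω => F n q.1 q.2)
    {Q : Kernel (Vec d) (Vec d)} (hQ : ∀ n, updateKernel P (F n) = Q) {X : ℕ → Ω → Vec d}
    {x₀ : Vec d} (hX0 : X 0 = fun _ => x₀) (hX : ∀ n, X (n + 1) = fun ω => F n (X n ω) ω) (n : ℕ) :
    Measurable (X n) ∧ P.map (X n) = (Q ^ n) x₀ := by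
  have hsup (n : ℕ) : ⨆ k ∈ Set.Iio n, 𝒜 k ≤ mΩ := iSup₂_le fun k _ => hle k
  have hadapted (n : ℕ) : Measurable[⨆ k ∈ Set.Iio n, 𝒜 k] (X n) := by
    induction n with
    | zero => rw [hX0]; exact measurable_const
    | succ n ih =>
      rw [hX]
      have hn : 𝒜 n ≤ ⨆ k ∈ Set.Iio (n + 1), 𝒜 k := le_iSup₂_of_le n n.lt_succ_self le_rfl
      refine measurable_eval hn (ih.mono ?_ le_rfl) (hF n)
      exact biSup_mono fun k (hk : k < n) => hk.trans n.lt_succ_self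
  refine ⟨(hadapted n).mono (hsup n) le_rfl, ?_⟩
  induction n with
  | zero => rw [hX0, Measure.map_const, measure_univ, one_smul, pow_zero_apply_eq_dirac]
  | succ n ih =>
    rw [hX, map_eval_eq_bind_updateKernel (hsup n) (hle n) (hind n) (hadapted n) (hF n), ih, hQ,
      pow_succ_apply_eq_bind]

end Freezing

section Translates

variable {E : Type*} [MeasurableSpace E] {μ : Measure E}

theorem exists_measureReal_sub_lt_of_pos {q : E → ℝ≥0∞} (hq : ∀ t, 0 < q t) {B : Set E}
    (hB : μ B ≠ ∞) {η : ℝ} (hη : 0 < η) :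
    ∃ ε : ℝ, 0 < ε ∧ μ.real B - η < μ.real {t ∈ B | ENNReal.ofReal ε ≤ q t} := by
  let S (n : ℕ) : Set E := {t ∈ B | ENNReal.ofReal ((n : ℝ) + 1)⁻¹ ≤ q t}
  have hmono : Monotone S := fun m n hmn t ht =>
    ⟨ht.1, (ENNReal.ofReal_le_ofReal (by gcongr)).trans ht.2⟩
  have hunion : ⋃ n, S n = B := by
    refine (Set.iUnion_subset fun n t ht => ht.1).antisymm fun t ht => ?_
    obtain ⟨n, hn⟩ := ENNReal.exists_inv_nat_lt (hq t).ne'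
    refine Set.mem_iUnion.2 ⟨n, ht, le_trans ?_ hn.le⟩
    rw [ENNReal.ofReal_inv_of_pos (by positivity), ENNReal.inv_le_inv,
      ENNReal.ofReal_add (by positivity) zero_le_one, ENNReal.ofReal_natCast]
    exact le_self_add
  have hlim : Tendsto (fun n => μ.real (S n)) atTop (𝓝 (μ.real B)) := by
    have hlim := tendsto_measure_iUnion_atTop (μ := μ) hmono
    rw [hunion] at hlim
    exact (ENNReal.tendsto_toReal hB).comp hlim
  obtain ⟨n, hn⟩ := (hlim.eventually (lt_mem_nhds (sub_lt_self _ hη))).exists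
  exact ⟨_, by positivity, hn⟩

theorem mul_measureReal_sub_le_withDensity {f : E → ℝ≥0∞} (hf : Measurable f)
    [IsFiniteMeasure (μ.withDensity f)] {B : Set E} (hB : μ B ≠ ∞) {ε η : ℝ} (hε : 0 < ε)
    (hη : μ.real B - η ≤ μ.real {t ∈ B | ENNReal.ofReal ε ≤ f t}) {A : Set E}
    (hA : MeasurableSet A) :
    ε * (μ.real (B ∩ A) - η) ≤ (μ.withDensity f).real A := by
  set S := {t ∈ B | ENNReal.ofReal ε ≤ f t}
  have hSB : S ⊆ B := fun t ht => ht.1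
  have hmarkov : ε * μ.real (S ∩ A) ≤ (μ.withDensity f).real A := by
    rw [← ENNReal.toReal_ofReal hε.le, measureReal_def, measureReal_def, ← ENNReal.toReal_mul]
    refine ENNReal.toReal_mono (measure_ne_top _ _) ?_
    calc ENNReal.ofReal ε * μ (S ∩ A)
        ≤ ENNReal.ofReal ε * μ.restrict A {t | ENNReal.ofReal ε ≤ f t} := by
          rw [Measure.restrict_apply' hA]
          gcongr
          exact fun t ht => ht.2
      _ ≤ μ.withDensity f A := by
          rw [withDensity_apply f hA]
          exact mul_meas_ge_le_lintegral hf _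
  refine le_trans ?_ hmarkov
  have hS := measureReal_inter_add_sdiff (μ := μ) (s := S) hA (measure_ne_top_of_subset hSB hB)
  have hB' := measureReal_inter_add_sdiff (μ := μ) (s := B) hA hB
  have hsdiff : μ.real (S \ A) ≤ μ.real (B \ A) :=
    measureReal_mono (Set.sdiff_subset_sdiff_left hSB)
      (measure_ne_top_of_subset Set.sdiff_subset hB)
  gcongr
  linarith

theorem exists_forall_mul_measureReal_sub_le {q : E → ℝ≥0∞} (hq : ∀ t, 0 < q t) {B : Set E}
    (hB : μ B ≠ ∞) {η : ℝ} (hη : 0 < η) :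
    ∃ ε, 0 < ε ∧ ∀ f : E → ℝ≥0∞, Measurable f → IsFiniteMeasure (μ.withDensity f) → q ≤ f →
      ∀ A, MeasurableSet A → ε * (μ.real (B ∩ A) - η) ≤ (μ.withDensity f).real A := by
  obtain ⟨ε, hε, hlt⟩ := exists_measureReal_sub_lt_of_pos hq hB hη
  refine ⟨ε, hε, fun f hf hfin hqf A hA => mul_measureReal_sub_le_withDensity hf hB hε ?_ hA⟩
  refine hlt.le.trans (measureReal_mono (fun t ht => ⟨ht.1, ht.2.trans (hqf t)⟩) ?_)
  exact measure_ne_top_of_subset (fun t ht => ht.1) hB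

variable [NormedAddCommGroup E] [BorelSpace E] [ProperSpace E]

theorem measureReal_ball_one_inter_le (μ : Measure E) [μ.IsAddHaarMeasure] {M : ℝ} {v : E}
    (hv : ‖v‖ ≤ M) (A : Set E) :
    μ.real (Metric.ball 0 1 ∩ A) ≤ μ.real (Metric.ball 0 (M + 1) ∩ (· + v) ⁻¹' A) := by
  calc μ.real (Metric.ball 0 1 ∩ A)
      = μ.real ((· + v) ⁻¹' (Metric.ball 0 1 ∩ A)) := by
        rw [measureReal_def, measureReal_def, measure_preimage_add_right]
    _ ≤ μ.real (Metric.ball 0 (M + 1) ∩ (· + v) ⁻¹' A) := by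
        refine measureReal_mono (fun t ht => ⟨?_, ht.2⟩)
          (measure_ne_top_of_subset Set.inter_subset_left measure_ball_lt_top.ne)
        have hball : ‖t + v‖ < 1 := mem_ball_zero_iff.1 ht.1
        rw [mem_ball_zero_iff]
        linarith [norm_le_norm_add_norm_sub' t (t + v), norm_sub_rev t (t + v),
          (congrArg norm (add_sub_cancel_left t v) : ‖t + v - t‖ = ‖v‖)]

theorem exists_haveCommonMass_withDensity_map_add_right (μ : Measure E) [μ.IsAddHaarMeasure]
    {q : E → ℝ≥0∞} (hq : ∀ t, 0 < q t) (M : ℝ) :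
    ∃ δ, 0 < δ ∧ ∀ f f' : E → ℝ≥0∞, Measurable f → Measurable f' →
      IsFiniteMeasure (μ.withDensity f) → IsFiniteMeasure (μ.withDensity f') → q ≤ f → q ≤ f' →
      ∀ v w : E, ‖v‖ ≤ M → ‖w‖ ≤ M →
        HaveCommonMass ((μ.withDensity f).map (· + v)) ((μ.withDensity f').map (· + w)) δ := by
  set m := μ.real (Metric.ball 0 1)
  have hm : 0 < m := ENNReal.toReal_pos (Metric.measure_ball_pos μ _ one_pos).ne'
    measure_ball_lt_top.ne
  obtain ⟨ε, hε, hminor⟩ := exists_forall_mul_measureReal_sub_le (μ := μ) hq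
    (B := Metric.ball 0 (M + 1)) measure_ball_lt_top.ne (div_pos hm four_pos)
  have htranslate (f : E → ℝ≥0∞) (hf : Measurable f) (hfin : IsFiniteMeasure (μ.withDensity f))
      (hqf : q ≤ f) (v : E) (hv : ‖v‖ ≤ M) (A : Set E) (hA : MeasurableSet A) :
      ε * (μ.real (Metric.ball 0 1 ∩ A) - m / 4) ≤ ((μ.withDensity f).map (· + v)).real A := by
    rw [map_measureReal_apply (measurable_add_const v) hA]
    refine le_trans ?_ (hminor f hf hfin hqf _ (measurable_add_const v hA))
    have := measureReal_ball_one_inter_le μ hv A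
    gcongr
  refine ⟨ε * (m / 2), by positivity, fun f f' hf hf' hfin hfin' hqf hqf' v w hv hw A hA => ?_⟩
  have hsplit : μ.real (Metric.ball 0 1 ∩ A) + μ.real (Metric.ball 0 1 ∩ Aᶜ) = m := by
    rw [← Set.sdiff_eq]
    exact measureReal_inter_add_sdiff hA measure_ball_lt_top.ne
  calc ε * (m / 2)
      = ε * (μ.real (Metric.ball 0 1 ∩ A) - m / 4)
        + ε * (μ.real (Metric.ball 0 1 ∩ Aᶜ) - m / 4) := by rw [← hsplit]; ring
    _ ≤ _ := add_le_add (htranslate f hf hfin hqf v hv A hA)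
        (htranslate f' hf' hfin' hqf' w hw Aᶜ hA.compl)

end Translates

section Tightness

variable {Ω E : Type*} [MeasurableSpace Ω] {P : Measure Ω} [IsProbabilityMeasure P]
  [NormedAddCommGroup E]

theorem sq_mul_measureReal_lt_norm_le {X : Ω → E} (hX : MemLp X 2 P) {N : ℝ} (hN : 0 ≤ N) :
    N ^ 2 * P.real {ω | N < ‖X ω‖} ≤ ∫ ω, ‖X ω‖ ^ 2 ∂P := by
  refine le_trans ?_ (mul_meas_ge_le_integral_of_nonneg (ae_of_all _ fun ω => by positivity)
    ((memLp_two_iff_integrable_sq_norm hX.1).1 hX) (N ^ 2))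
  refine mul_le_mul_of_nonneg_left (measureReal_mono fun ω hω => ?_) (sq_nonneg N)
  exact pow_le_pow_left₀ hN (le_of_lt hω) 2

variable [MeasurableSpace E] [OpensMeasurableSpace E]

theorem half_le_measureReal_norm_le {X : Ω → E} (hXm : Measurable X) (hX : MemLp X 2 P) {B : ℝ}
    (hB : ∫ ω, ‖X ω‖ ^ 2 ∂P ≤ B) : 1 / 2 ≤ P.real {ω | ‖X ω‖ ≤ 1 + 2 * B} := by
  have hB0 : 0 ≤ B := le_trans (integral_nonneg fun ω => sq_nonneg _) hB
  have hcheb := (sq_mul_measureReal_lt_norm_le hX (by positivity : 0 ≤ 1 + 2 * B)).trans hB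
  have hcompl : {ω | ‖X ω‖ ≤ 1 + 2 * B} = {ω | 1 + 2 * B < ‖X ω‖}ᶜ := by
    ext ω
    simp
  rw [hcompl, probReal_compl_eq_one_sub (measurableSet_lt measurable_const hXm.norm)]
  nlinarith [measureReal_nonneg (μ := P) (s := {ω | 1 + 2 * B < ‖X ω‖})]

theorem measureReal_norm_mul_measureReal_norm_le_of_indepFun {X Y : Ω → E} (hind : IndepFun X Y P)
    (r N : ℝ) :
    P.real {ω | ‖X ω‖ < r} * P.real {ω | N + r < ‖Y ω‖} ≤ P.real {ω | N < ‖X ω + Y ω‖} := by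
  have hprod := hind.measure_inter_preimage_eq_mul {z | ‖z‖ < r} {z | N + r < ‖z‖}
    (measurableSet_lt measurable_norm measurable_const)
    (measurableSet_lt measurable_const measurable_norm)
  calc P.real {ω | ‖X ω‖ < r} * P.real {ω | N + r < ‖Y ω‖}
      = P.real ({ω | ‖X ω‖ < r} ∩ {ω | N + r < ‖Y ω‖}) := by
        rw [measureReal_def, measureReal_def, ← ENNReal.toReal_mul]
        exact congrArg ENNReal.toReal hprod.symm
    _ ≤ P.real {ω | N < ‖X ω + Y ω‖} := by
        refine measureReal_mono fun ω hω => ?_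
        have hX : ‖X ω‖ < r := hω.1
        have hY : N + r < ‖Y ω‖ := hω.2
        have hXY := norm_sub_le (X ω + Y ω) (X ω)
        rw [add_sub_cancel_left] at hXY
        change N < ‖X ω + Y ω‖
        linarith

theorem half_le_measureReal_norm_le_of_indepFun {X Y : Ω → E} (hY : Measurable Y)
    (hind : IndepFun X Y P) (hXY : MemLp (fun ω => X ω + Y ω) 2 P) {σ : ℝ}
    (hσ : ∫ ω, ‖X ω + Y ω‖ ^ 2 ∂P ≤ σ ^ 2) {c r : ℝ} (hc : 0 < c)
    (hX : c ≤ P.real {ω | ‖X ω‖ < r}) :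
    1 / 2 ≤ P.real {ω | ‖Y ω‖ ≤ 1 + 2 * σ ^ 2 / c + r} := by
  set N := 1 + 2 * σ ^ 2 / c
  have hN1 : 1 ≤ N := le_add_of_nonneg_right (by positivity)
  have hN : 2 * σ ^ 2 ≤ c * N ^ 2 := by
    have hcN : c * N = c + 2 * σ ^ 2 := by simp only [N]; field_simp
    nlinarith [mul_nonneg hc.le (mul_nonneg (by linarith : 0 ≤ N) (sub_nonneg.2 hN1))]
  have hcheb := (sq_mul_measureReal_lt_norm_le hXY (by linarith : 0 ≤ N)).trans hσ
  have htail : c * P.real {ω | N + r < ‖Y ω‖} ≤ P.real {ω | N < ‖X ω + Y ω‖} :=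
    (mul_le_mul_of_nonneg_right hX measureReal_nonneg).trans
      (measureReal_norm_mul_measureReal_norm_le_of_indepFun hind r N)
  have hhalf : P.real {ω | N + r < ‖Y ω‖} ≤ 1 / 2 := by
    have hpos : 0 < c * N ^ 2 := by positivity
    refine le_of_mul_le_mul_left ?_ hpos
    nlinarith [mul_le_mul_of_nonneg_left htail (sq_nonneg N)]
  have hcompl : {ω | ‖Y ω‖ ≤ N + r} = {ω | N + r < ‖Y ω‖}ᶜ := by
    ext ω
    simp
  rw [hcompl, probReal_compl_eq_one_sub (measurableSet_lt measurable_const hY.norm)]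
  linarith

end Tightness

section Noise

variable {d : ℕ} {Ω : Type*} [mΩ : MeasurableSpace Ω] {P : Measure Ω} {u : Vec d → Ω → Vec d}
  {σ : ℝ}

/-- A jointly measurable random field whose values are centered, with second moment at most `σ ^ 2`:
what remains of the conditional assumptions of `OracleNoise` for a single query. -/
structure CenteredNoise (P : Measure Ω) (u : Vec d → Ω → Vec d) (σ : ℝ) : Prop where
  measurable : Measurable fun q : Vec d × Ω => u q.1 q.2
  memLp : ∀ x, MemLp (u x) 2 P
  integral_eq_zero : ∀ x, ∫ ω, u x ω ∂P = 0
  integral_norm_sq_le : ∀ x, ∫ ω, ‖u x ω‖ ^ 2 ∂P ≤ σ ^ 2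

theorem CenteredNoise.measurable_apply (hu : CenteredNoise P u σ) (x : Vec d) :
    Measurable (u x) :=
  hu.measurable.comp measurable_prodMk_left

theorem OracleNoise.centeredNoise [IsProbabilityMeasure P] {κ : Type*} {ℱ : Filtration ℕ mΩ}
    {time : κ → ℕ} {U : κ → Vec d → Ω → Vec d} (h : OracleNoise P ℱ time U σ) (k : κ) :
    CenteredNoise P (U k) σ where
  measurable := measurable_of_measurable_prod (ℱ.le _) (h.adapted k)
  memLp := h.sq_integrable k
  integral_eq_zero x := by
    rw [← integral_condExp (ℱ.le (time k)), integral_congr_ae (h.zero_mean k x)]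
    simp
  integral_norm_sq_le x := by
    rw [← integral_condExp (ℱ.le (time k))]
    simpa using integral_mono_ae integrable_condExp (integrable_const _) (h.second_moment k x)

variable [IsProbabilityMeasure P]

theorem map_add_add_eq_bind {X Y : Ω → Vec d} (hX : Measurable X) (hY : Measurable Y)
    (hind : IndepFun X Y P) (v : Vec d) :
    P.map (fun ω => X ω + Y ω + v)
      = (P.map Y).bind (updateKernel P fun z ω => X ω + (z + v)) := by
  simp only [add_assoc]
  exact map_eval_eq_bind_updateKernel hY.comap_le hX.comap_le
    ((IndepFun_iff_Indep _ _ _).1 hind).symm (comap_measurable Y)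
    (F := fun z ω => X ω + (z + v))
    (((comap_measurable X).comp (@measurable_snd _ _ _ (MeasurableSpace.comap X inferInstance))).add
      ((@measurable_fst _ _ _ (MeasurableSpace.comap X inferInstance)).add_const v))

theorem exists_forall_half_le_measureReal_norm_le {ι : Type*} {X Y : ι → Ω → Vec d}
    {p : ι → Vec d → ℝ≥0∞} {C : Set ι} (hp : ∀ t, 0 < ⨅ x ∈ C, p x t)
    (hX : ∀ x, Measurable (X x)) (hY : ∀ x, Measurable (Y x)) (hind : ∀ x, IndepFun (X x) (Y x) P)
    (hpX : ∀ x, Measurable (p x) ∧ P.map (X x) = volume.withDensity (p x))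
    (hXY : ∀ x, MemLp (fun ω => X x ω + Y x ω) 2 P)
    (hσ : ∀ x, ∫ ω, ‖X x ω + Y x ω‖ ^ 2 ∂P ≤ σ ^ 2) :
    ∃ N, ∀ x ∈ C, 1 / 2 ≤ P.real {ω | ‖Y x ω‖ ≤ N} := by
  set m := volume.real (Metric.ball (0 : Vec d) 1)
  have hm : 0 < m := ENNReal.toReal_pos (Metric.measure_ball_pos volume _ one_pos).ne'
    measure_ball_lt_top.ne
  obtain ⟨ε, hε, hminor⟩ := exists_forall_mul_measureReal_sub_le (μ := volume) hp
    (B := Metric.ball 0 1) measure_ball_lt_top.ne (half_pos hm)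
  refine ⟨_, fun x hx => half_le_measureReal_norm_le_of_indepFun (hY x) (hind x) (hXY x) (hσ x)
    (mul_pos hε (half_pos hm)) (r := 1) ?_⟩
  have hle := hminor (p x) (hpX x).1 ((hpX x).2 ▸ inferInstance) (fun t => iInf₂_le x hx) _
    (Metric.isOpen_ball (x := (0 : Vec d)) (ε := 1)).measurableSet
  rw [Set.inter_self, sub_half, ← (hpX x).2, map_measureReal_apply (hX x)
    Metric.isOpen_ball.measurableSet] at hle
  simpa [Set.preimage, m] using hle

theorem PositiveDensityPart.exists_haveCommonMass_add {κ : Type*} {U : κ → Vec d → Ω → Vec d}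
    (h : PositiveDensityPart P U) {k : κ} (hu : CenteredNoise P (U k) σ) {C : Set (Vec d)}
    (hC : Bornology.IsBounded C) (M : ℝ) :
    ∃ δ, 0 < δ ∧ ∀ x ∈ C, ∀ y ∈ C, ∀ v w : Vec d, ‖v‖ ≤ M → ‖w‖ ≤ M →
      HaveCommonMass (P.map fun ω => U k x ω + v) (P.map fun ω => U k y ω + w) δ := by
  obtain ⟨X, Y, p, hXY, hX, hp, hpos⟩ := h k
  have hUXY (x : Vec d) : U k x = fun ω => X x ω + Y x ω := funext (hXY x)
  have hY (x : Vec d) : Measurable (Y x) := by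
    have : Y x = fun ω => U k x ω - X x ω := funext fun ω => by rw [hXY, add_sub_cancel_left]
    exact this ▸ (hu.measurable_apply x).sub (hX x).1
  obtain ⟨N, hN⟩ := exists_forall_half_le_measureReal_norm_le (hpos C hC) (fun x => (hX x).1) hY
    (fun x => (hX x).2) hp (fun x => hUXY x ▸ hu.memLp x)
    (fun x => by simpa only [hXY] using hu.integral_norm_sq_le x)
  obtain ⟨δ, hδ, hoverlap⟩ :=
    exists_haveCommonMass_withDensity_map_add_right volume (hpos C hC) (N + M)
  have hfin (x : Vec d) : IsFiniteMeasure (volume.withDensity (p x)) := (hp x).2 ▸ inferInstance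
  refine ⟨1 / 2 * δ, by positivity, fun x hx y hy v w hv hw => ?_⟩
  have hF (x v : Vec d) : Measurable fun q : Vec d × Ω => X x q.2 + (q.1 + v) :=
    ((hX x).1.comp measurable_snd).add (measurable_fst.add_const v)
  have hlaw (x z v : Vec d) : updateKernel P (fun z ω => X x ω + (z + v)) z
      = (volume.withDensity (p x)).map (· + (z + v)) := by
    rw [updateKernel_apply (hF x v), ← (hp x).2, Measure.map_map (measurable_add_const _) (hX x).1]
    rfl
  have hmass (x : Vec d) (hx : x ∈ C) : 1 / 2 ≤ (P.map (Y x)).real {z | ‖z‖ ≤ N} := by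
    rw [map_measureReal_apply (hY x) (measurableSet_le measurable_norm measurable_const)]
    exact hN x hx
  have hker (x v : Vec d) :=
    isMarkovKernel_updateKernel (P := P) (F := fun z ω => X x ω + (z + v)) (hF x v)
  simp only [hUXY, map_add_add_eq_bind (hX _).1 (hY _) (hX _).2]
  refine HaveCommonMass.bind one_half_pos (hmass x hx) (hmass y hy) fun z hz z' hz' => ?_
  rw [hlaw, hlaw]
  exact hoverlap _ _ (hp x).1 (hp y).1 (hfin x) (hfin y) (fun t => iInf₂_le x hx)
    (fun t => iInf₂_le y hy) _ _ ((norm_add_le _ _).trans (add_le_add hz hv))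
    ((norm_add_le _ _).trans (add_le_add hz' hw))

end Noise

section Limit

variable {d : ℕ} {Ω : Type*} [MeasurableSpace Ω] {P : Measure Ω} {xs : Vec d}

theorem norm_le_of_sq_norm_sub_le {E : Type*} [NormedAddCommGroup E] {x y : E} {r : ℝ}
    (h : ‖x - y‖ ^ 2 ≤ r) : ‖x‖ ≤ ‖y‖ + 1 + r := by
  nlinarith [norm_le_norm_add_norm_sub' x y, sq_nonneg (‖x - y‖ - 1)]

theorem weightedOsc_of_abs_le {E : Type*} [NormedAddCommGroup E] {f : E → ℝ} {C β : ℝ}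
    (hC : 0 ≤ C) (hf : ∀ x, |f x| ≤ C * (1 + ‖x‖)) (hβ : 0 < β) (y : E) :
    WeightedOsc (fun x => ‖x - y‖ ^ 2) β (C * (2 + ‖y‖ + β⁻¹)) f := by
  refine ⟨0, fun x => ?_⟩
  have hexpand : (2 + ‖y‖ + β⁻¹) * (1 + β * ‖x - y‖ ^ 2)
      = 2 + ‖y‖ + ‖x - y‖ ^ 2 + (β⁻¹ + (2 + ‖y‖) * (β * ‖x - y‖ ^ 2)) := by
    field_simp
    ring
  have hrest : 0 ≤ β⁻¹ + (2 + ‖y‖) * (β * ‖x - y‖ ^ 2) := by positivity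
  rw [sub_zero, mul_assoc]
  refine (hf x).trans (mul_le_mul_of_nonneg_left ?_ hC)
  linarith [norm_le_of_sq_norm_sub_le (le_refl (‖x - y‖ ^ 2))]

theorem tvDist_le_of_forall_abs_sub_le {ν π : Measure (Vec d)} {c : ℝ}
    (h : ∀ A, MeasurableSet A → |ν.real A - π.real A| ≤ c) : tvDist ν π ≤ c := by
  have : Nonempty {A : Set (Vec d) // MeasurableSet A} := ⟨⟨∅, MeasurableSet.empty⟩⟩
  exact ciSup_le fun A => h A.1 A.2

theorem integrable_sq_norm_of_integrable_sq_norm_sub {π : Measure (Vec d)} [IsFiniteMeasure π]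
    (h : Integrable (fun x => ‖x - xs‖ ^ 2) π) : Integrable (fun x => ‖x‖ ^ 2) π := by
  have hsub : MemLp (fun x => x - xs) 2 π := (memLp_two_iff_integrable_sq_norm (by fun_prop)).2 h
  have hid : MemLp (fun x : Vec d => x) 2 π := by
    simpa [Pi.add_def] using hsub.add (memLp_const xs)
  exact (memLp_two_iff_integrable_sq_norm hid.1).1 hid

variable {Q : Kernel (Vec d) (Vec d)} {X : Vec d → ℕ → Ω → Vec d} {π : Measure (Vec d)}

theorem GeometricallyErgodic.isGeometricLimit [IsMarkovKernel Q]
    (h : GeometricallyErgodic Q (fun x => ‖x - xs‖ ^ 2) π)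
    (hint : ∀ n x, Integrable (fun x => ‖x - xs‖ ^ 2) ((Q ^ n) x))
    (hX : ∀ x n, Measurable (X x n) ∧ P.map (X x n) = (Q ^ n) x) : IsGeometricLimit P Q X π := by
  have := h.prob
  obtain ⟨β, ρ, hβ, hρ0, hρ1, hconv⟩ := h.converges
  have : 0 ≤ ∫ x, ‖x - xs‖ ^ 2 ∂π := integral_nonneg fun x => sq_nonneg _
  refine ⟨h.prob, h.invariant, h.unique,
    integrable_sq_norm_of_integrable_sq_norm_sub h.integrable, ?_,
    ρ, hρ0, hρ1, fun x₀ => ⟨1 * (2 + β * (‖x₀ - xs‖ ^ 2 + ∫ x, ‖x - xs‖ ^ 2 ∂π)),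
      by positivity, fun n => tvDist_le_of_forall_abs_sub_le fun A hA => ?_⟩⟩
  · rintro f hf ⟨C, hC, hfC⟩
    have hosc := weightedOsc_of_abs_le hC.le hfC hβ xs
    refine ⟨hosc.integrable hf h.integrable, ρ, hρ0, hρ1, fun x₀ =>
      ⟨C * (2 + ‖xs‖ + β⁻¹) * (2 + β * (‖x₀ - xs‖ ^ 2 + ∫ x, ‖x - xs‖ ^ 2 ∂π)),
        by positivity, fun n => ?_⟩⟩
    have hfn := hosc.integrable hf (hint n x₀)
    have hbound := hconv _ f (by positivity) hf hosc x₀ n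
    rw [← (hX x₀ n).2] at hfn hbound
    rw [integral_map (hX x₀ n).1.aemeasurable hf.aestronglyMeasurable] at hbound
    exact ⟨hfn.comp_measurable (hX x₀ n).1, hbound⟩
  · have hbound := hconv 1 _ zero_le_one (measurable_one.indicator hA)
      (weightedOsc_indicator (fun x => sq_nonneg _) hβ.le A) x₀ n
    rwa [integral_indicator_one hA, integral_indicator_one hA, ← (hX x₀ n).2] at hbound

theorem GeometricDrift.integral_le_of_invariant {E : Type*} [MeasurableSpace E] {Q : Kernel E E}
    {W : E → ℝ} {κ b : ℝ} (h : GeometricDrift Q W κ b) (hκ : κ < 1) {π : Measure E}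
    [IsProbabilityMeasure π] (hπ : Q.Invariant π) (hW : Integrable W π) :
    ∫ x, W x ∂π ≤ b / (1 - κ) := by
  have hdrift := h.integral_bind_le hW
  rw [hπ.def] at hdrift
  rw [le_div_iff₀ (by linarith)]
  linarith

theorem exists_isGeometricLimit [IsMarkovKernel Q] {κ b : ℝ}
    (h : GeometricDrift Q (fun x => ‖x - xs‖ ^ 2) κ b) (hκ : κ < 1)
    (hQ : LocallyOverlapping Q fun x => ‖x - xs‖ ^ 2)
    (hX : ∀ x n, Measurable (X x n) ∧ P.map (X x n) = (Q ^ n) x) :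
    ∃ π : Measure (Vec d), IsGeometricLimit P Q X π ∧
      Integrable (fun x => ‖x - xs‖ ^ 2) π ∧ ∫ x, ‖x - xs‖ ^ 2 ∂π ≤ b / (1 - κ) := by
  have h' : GeometricDrift Q (fun x => ‖x - xs‖ ^ 2) (max κ 0) (|b| + 1) :=
    h.mono (le_max_left κ 0) (by linarith [le_abs_self b])
  have hκ0 : 0 ≤ max κ 0 := le_max_right κ 0
  have hκ1 : max κ 0 < 1 := max_lt hκ one_pos
  obtain ⟨π, hπ⟩ := h'.exists_geometricallyErgodic hκ0 hκ1 (by positivity) hQ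
  have := hπ.prob
  exact ⟨π, hπ.isGeometricLimit (fun n => (h'.pow hκ0 hκ1 (by positivity) n).integrable) hX,
    hπ.integrable, h.integral_le_of_invariant hκ hπ.invariant hπ.integrable⟩

end Limit

section Bias

variable {d : ℕ} {V : Vec d → Vec d} {π : Measure (Vec d)} {xs : Vec d} {lam μ : ℝ}

theorem integral_norm_le_sqrt_integral_sq_norm {Ω E : Type*} [MeasurableSpace Ω]
    [NormedAddCommGroup E] {P : Measure Ω} [IsProbabilityMeasure P] {X : Ω → E}
    (hX : MemLp X 2 P) : ∫ ω, ‖X ω‖ ∂P ≤ √(∫ ω, ‖X ω‖ ^ 2 ∂P) := by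
  have hvar := variance_nonneg (fun ω => ‖X ω‖) P
  rw [variance_eq_sub hX.norm, sub_nonneg] at hvar
  exact Real.le_sqrt_of_sq_le hvar

theorem abs_integral_sub_le_of_lipschitzWith [IsProbabilityMeasure π] {f : Vec d → ℝ} {L : ℝ≥0}
    (hf : LipschitzWith L f) {y : Vec d} (hy : Integrable (fun x => ‖x - y‖ ^ 2) π) :
    |∫ x, f x ∂π - f y| ≤ L * √(∫ x, ‖x - y‖ ^ 2 ∂π) := by
  have hsub : MemLp (fun x => x - y) 2 π := (memLp_two_iff_integrable_sq_norm (by fun_prop)).2 hy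
  have hnorm : Integrable (fun x => ‖x - y‖) π := (hsub.integrable one_le_two).norm
  have hlip (x : Vec d) : |f x - f y| ≤ L * ‖x - y‖ := by
    rw [← Real.norm_eq_abs]
    simpa only [dist_eq_norm] using hf.dist_le_mul x y
  have hdiff : Integrable (fun x => f x - f y) π :=
    (hnorm.const_mul (L : ℝ)).mono' (hf.continuous.measurable.sub_const _).aestronglyMeasurable
      (ae_of_all _ hlip)
  have hfint : Integrable f π :=
    (hdiff.add (integrable_const (f y))).congr (ae_of_all _ fun x => sub_add_cancel (f x) (f y))
  calc |∫ x, f x ∂π - f y| = |∫ x, (f x - f y) ∂π| := by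
        simp [integral_sub hfint (integrable_const _)]
    _ ≤ ∫ x, |f x - f y| ∂π := abs_integral_le_integral_abs
    _ ≤ ∫ x, L * ‖x - y‖ ∂π := integral_mono hdiff.abs (hnorm.const_mul _) hlip
    _ = L * ∫ x, ‖x - y‖ ∂π := integral_const_mul _ _
    _ ≤ L * √(∫ x, ‖x - y‖ ^ 2 ∂π) := by
        gcongr
        exact integral_norm_le_sqrt_integral_sq_norm hsub

theorem sq_norm_sub_le_of_mem_solutions (hμ : 0 < μ)
    (h : ∀ x, μ * ‖x - xs‖ ^ 2 - lam ≤ inner ℝ (V x) (x - xs)) {y : Vec d}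
    (hy : y ∈ solutions V) : ‖y - xs‖ ^ 2 ≤ lam / μ := by
  have hmon := h y
  rw [show V y = 0 from hy, inner_zero_left] at hmon
  rw [le_div_iff₀ hμ]
  linarith

theorem lipschitzBias_of_integral_sq_le [IsProbabilityMeasure π] (hμ : 0 < μ)
    (h : ∀ x, μ * ‖x - xs‖ ^ 2 - lam ≤ inner ℝ (V x) (x - xs))
    (hint : Integrable (fun x => ‖x - xs‖ ^ 2) π) {B D : ℝ} (hB : ∫ x, ‖x - xs‖ ^ 2 ∂π ≤ B)
    (hD : 2 * B + 2 * (lam / μ) ≤ D) : LipschitzBias V π D := by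
  intro f L hf y hy
  have hmajor : Integrable (fun x => 2 * ‖x - xs‖ ^ 2 + 2 * (lam / μ)) π :=
    (hint.const_mul 2).add (integrable_const _)
  have hle (x : Vec d) : ‖x - y‖ ^ 2 ≤ 2 * ‖x - xs‖ ^ 2 + 2 * (lam / μ) := by
    have htri : ‖x - y‖ ≤ ‖x - xs‖ + ‖y - xs‖ := by
      simpa only [sub_sub_sub_cancel_right] using norm_sub_le (x - xs) (y - xs)
    have hsq := pow_le_pow_left₀ (norm_nonneg _) htri 2
    linarith [add_sq_le (a := ‖x - xs‖) (b := ‖y - xs‖),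
      sq_norm_sub_le_of_mem_solutions hμ h hy]
  have hsq : Integrable (fun x => ‖x - y‖ ^ 2) π :=
    hmajor.mono' (by fun_prop) (ae_of_all _ fun x => by simpa using hle x)
  refine (abs_integral_sub_le_of_lipschitzWith hf hsq).trans ?_
  gcongr
  calc ∫ x, ‖x - y‖ ^ 2 ∂π ≤ ∫ x, (2 * ‖x - xs‖ ^ 2 + 2 * (lam / μ)) ∂π :=
        integral_mono hsq hmajor hle
    _ = 2 * ∫ x, ‖x - xs‖ ^ 2 ∂π + 2 * (lam / μ) := by
        simp [integral_add (hint.const_mul 2) (integrable_const _), integral_const_mul]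
    _ ≤ D := by linarith

end Bias

section Query

variable {d : ℕ} {Ω : Type*} {V : Vec d → Vec d} {s : ℝ} {u : Vec d → Ω → Vec d}

/-- The point reached from `x` by a step of size `s` along the noisy value of `V` at `y`. Steps of
SGDA have `y = x`; the second half of a SEG step has `y` equal to the look-ahead point. -/
def queryStep (V : Vec d → Vec d) (s : ℝ) (u : Vec d → Ω → Vec d) (x y : Vec d) (ω : Ω) : Vec d :=
  x - s • (V y + u y ω)

theorem measurable_queryStep {E : Type*} {_ : MeasurableSpace E} {m : MeasurableSpace Ω}
    (hV : Measurable V)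
    (hu : Measurable[MeasurableSpace.prod inferInstance m] fun q : Vec d × Ω => u q.1 q.2)
    {f g : E → Vec d} {h : E → Ω} (hf : Measurable f) (hg : Measurable g) (hh : Measurable h) :
    Measurable fun q => queryStep V s u (f q) (g q) (h q) :=
  hf.sub (((hV.comp hg).add (hu.comp (hg.prodMk hh))).const_smul s)

variable [mΩ : MeasurableSpace Ω] {P : Measure Ω} {κ : Type*} {U : κ → Vec d → Ω → Vec d}

theorem IIDFields.measurable (h : IIDFields P U) (k : κ) :
    Measurable fun q : Vec d × Ω => U k q.1 q.2 := by
  obtain ⟨𝒢, hle, -, hmeas⟩ := h.indep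
  exact measurable_of_measurable_prod (hle k) (hmeas k)

theorem IIDFields.map_queryStep_eq (h : IIDFields P U) (k l : κ) (x y : Vec d) :
    P.map (queryStep V s (U k) x y) = P.map (queryStep V s (U l) x y) := by
  have hg : Measurable fun w : Vec d → Vec d => x - s • (V y + w y) := by fun_prop
  exact ((h.ident k l).comp hg).map_eq

variable [IsProbabilityMeasure P] {σ : ℝ}

theorem IIDFields.updateKernel_queryStep_eq (h : IIDFields P U) (hV : Measurable V)
    {f g : Vec d → Vec d} (hf : Measurable f) (hg : Measurable g) (k l : κ) :
    updateKernel P (fun x ω => queryStep V s (U k) (f x) (g x) ω)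
      = updateKernel P fun x ω => queryStep V s (U l) (f x) (g x) ω := by
  have hjoint (k : κ) : Measurable fun q : Vec d × Ω => queryStep V s (U k) (f q.1) (g q.1) q.2 :=
    measurable_queryStep hV (h.measurable k) (hf.comp measurable_fst) (hg.comp measurable_fst)
      measurable_snd
  ext x : 1
  rw [updateKernel_apply (hjoint k), updateKernel_apply (hjoint l)]
  exact h.map_queryStep_eq k l (f x) (g x)

theorem integral_sq_norm_queryStep_sub_le (hu : CenteredNoise P u σ) (x y z : Vec d) :
    Integrable (fun ω => ‖queryStep V s u x y ω - z‖ ^ 2) P ∧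
      ∫ ω, ‖queryStep V s u x y ω - z‖ ^ 2 ∂P ≤ ‖x - z - s • V y‖ ^ 2 + s ^ 2 * σ ^ 2 := by
  set a := x - z - s • V y
  have huint : Integrable (u y) P := (hu.memLp y).integrable one_le_two
  have husq : Integrable (fun ω => ‖u y ω‖ ^ 2) P :=
    (memLp_two_iff_integrable_sq_norm (hu.memLp y).1).1 (hu.memLp y)
  have hinner : Integrable (fun ω => inner ℝ a (u y ω)) P := huint.const_inner a
  have hexpand (ω : Ω) : ‖queryStep V s u x y ω - z‖ ^ 2
      = ‖a‖ ^ 2 - 2 * s * inner ℝ a (u y ω) + s ^ 2 * ‖u y ω‖ ^ 2 := by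
    have : queryStep V s u x y ω - z = a - s • u y ω := by
      simp only [queryStep, a, smul_add]
      abel
    rw [this, norm_sub_sq_real, real_inner_smul_right, norm_smul, mul_pow, Real.norm_eq_abs,
      sq_abs]
    ring
  have hlin : Integrable (fun ω => ‖a‖ ^ 2 - 2 * s * inner ℝ a (u y ω)) P :=
    (integrable_const _).sub (hinner.const_mul _)
  simp_rw [hexpand]
  refine ⟨hlin.add (husq.const_mul _), ?_⟩
  rw [integral_add hlin (husq.const_mul _), integral_sub (integrable_const _) (hinner.const_mul _),
    integral_const_mul, integral_const_mul, integral_inner huint, hu.integral_eq_zero,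
    inner_zero_right]
  simp only [integral_const, probReal_univ, smul_eq_mul, one_mul, mul_zero, sub_zero]
  gcongr
  exact hu.integral_norm_sq_le y

theorem LinearGrowth.exists_haveCommonMass_queryStep {G : ℝ} (hVG : LinearGrowth V G)
    (h : PositiveDensityPart P U) {k : κ} (hu : CenteredNoise P (U k) σ) (hs : s ≠ 0) (r : ℝ) :
    ∃ δ, 0 < δ ∧ ∀ x y x' y' : Vec d, ‖x‖ ≤ r → ‖y‖ ≤ r → ‖x'‖ ≤ r → ‖y'‖ ≤ r →
      HaveCommonMass (P.map (queryStep V s (U k) x y)) (P.map (queryStep V s (U k) x' y')) δ := by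
  obtain ⟨δ, hδ, hoverlap⟩ := h.exists_haveCommonMass_add hu
    (Metric.isBounded_closedBall (x := (0 : Vec d)) (r := r)) (|G| * (1 + r) + |s⁻¹| * r)
  refine ⟨δ, hδ, fun x y x' y' hx hy hx' hy' => ?_⟩
  have hlaw (x y : Vec d) : P.map (queryStep V s (U k) x y)
      = (P.map fun ω => U k y ω + (V y - s⁻¹ • x)).map fun z => -s • z := by
    rw [Measure.map_map (measurable_const_smul _) ((hu.measurable_apply y).add_const _)]
    refine congrArg P.map (funext fun ω => ?_)
    simp only [queryStep, Function.comp_apply, neg_smul, smul_add, smul_sub,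
      smul_inv_smul₀ hs]
    abel
  have hshift {x y : Vec d} (hx : ‖x‖ ≤ r) (hy : ‖y‖ ≤ r) :
      ‖V y - s⁻¹ • x‖ ≤ |G| * (1 + r) + |s⁻¹| * r := by
    refine (norm_sub_le _ _).trans (add_le_add ((hVG y).trans ?_) ?_)
    · exact mul_le_mul (le_abs_self G) (by linarith) (by positivity) (abs_nonneg G)
    · rw [norm_smul, Real.norm_eq_abs]
      gcongr
  rw [hlaw, hlaw]
  exact (hoverlap y (by simpa using hy) y' (by simpa using hy') _ _ (hshift hx hy)
    (hshift hx' hy')).map (measurable_const_smul _)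

end Query

section SGDA

variable {d : ℕ} {V : Vec d → Vec d} {xs : Vec d} {σ γ lam μ G : ℝ}

theorem LinearGrowth.sq_norm_le (hVG : LinearGrowth V G) (x xs : Vec d) :
    ‖V x‖ ^ 2 ≤ G ^ 2 * (3 * (1 + ‖xs‖) ^ 2 + 3 / 2 * ‖x - xs‖ ^ 2) := by
  have htri : 1 + ‖x‖ ≤ (1 + ‖xs‖) + ‖x - xs‖ := by linarith [norm_le_norm_add_norm_sub' x xs]
  calc ‖V x‖ ^ 2 ≤ (G * (1 + ‖x‖)) ^ 2 := by gcongr; exact hVG x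
    _ = G ^ 2 * (1 + ‖x‖) ^ 2 := mul_pow _ _ _
    _ ≤ G ^ 2 * ((1 + ‖xs‖) + ‖x - xs‖) ^ 2 := by gcongr
    _ ≤ G ^ 2 * (3 * (1 + ‖xs‖) ^ 2 + 3 / 2 * ‖x - xs‖ ^ 2) := by
        gcongr
        linarith [sq_nonneg (2 * (1 + ‖xs‖) - ‖x - xs‖)]

theorem LinearGrowth.sq_norm_sub_smul_le (hVG : LinearGrowth V G) {x : Vec d}
    (hx : μ * ‖x - xs‖ ^ 2 - lam ≤ inner ℝ (V x) (x - xs)) (hγ : 0 ≤ γ) (hγμ : γ * G ^ 2 ≤ μ) :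
    ‖x - xs - γ • V x‖ ^ 2 ≤ (1 - γ * μ / 2) * ‖x - xs‖ ^ 2
      + (2 * γ * lam + 3 * γ ^ 2 * G ^ 2 * (1 + ‖xs‖) ^ 2) := by
  have hgrowth : γ ^ 2 * ‖V x‖ ^ 2
      ≤ 3 * γ ^ 2 * G ^ 2 * (1 + ‖xs‖) ^ 2 + 3 / 2 * (γ * (γ * G ^ 2) * ‖x - xs‖ ^ 2) := by
    linarith [mul_le_mul_of_nonneg_left (hVG.sq_norm_le x xs) (sq_nonneg γ)]
  have hstep : γ * (γ * G ^ 2) * ‖x - xs‖ ^ 2 ≤ γ * μ * ‖x - xs‖ ^ 2 := by gcongr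
  rw [norm_sub_sq_real, real_inner_smul_right, norm_smul, mul_pow, Real.norm_of_nonneg hγ,
    real_inner_comm]
  linarith [mul_le_mul_of_nonneg_left hx hγ]

variable {Ω : Type*} [mΩ : MeasurableSpace Ω] {P : Measure Ω} [IsProbabilityMeasure P]
  {U : ℕ → Vec d → Ω → Vec d}

theorem sgdaKernel_apply (hV : Measurable V) (hU : Measurable fun q : Vec d × Ω => U 0 q.1 q.2)
    (x : Vec d) : sgdaKernel P V γ U x = P.map (queryStep V γ (U 0) x x) :=
  updateKernel_apply (F := fun x => queryStep V γ (U 0) x x)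
    (measurable_queryStep hV hU measurable_fst measurable_fst measurable_snd) x

theorem isMarkovKernel_sgdaKernel (hV : Measurable V)
    (hU : Measurable fun q : Vec d × Ω => U 0 q.1 q.2) : IsMarkovKernel (sgdaKernel P V γ U) :=
  isMarkovKernel_updateKernel
    (measurable_queryStep hV hU measurable_fst measurable_fst measurable_snd)

theorem measurable_and_map_sgda_eq_pow (hV : Measurable V) (h : IIDFields P U) (x₀ : Vec d)
    (n : ℕ) : Measurable (sgda V γ U x₀ n) ∧
      P.map (sgda V γ U x₀ n) = (sgdaKernel P V γ U ^ n) x₀ := by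
  obtain ⟨𝒢, hle, hind, hmeas⟩ := h.indep
  have hpast (n : ℕ) : Indep (⨆ k ∈ Set.Iio n, 𝒢 k) (𝒢 n) P := by
    simpa using indep_iSup_of_disjoint hle hind (S := Set.Iio n) (T := {n}) (by simp)
  exact measurable_and_map_eq_pow hle hpast (F := fun n x ω => queryStep V γ (U n) x x ω)
    (fun n => measurable_queryStep hV (hmeas n) measurable_fst measurable_fst measurable_snd)
    (fun n => h.updateKernel_queryStep_eq hV measurable_id measurable_id n 0) rfl (fun n => rfl) n

theorem geometricDrift_sgdaKernel (hV : Measurable V) (hu : CenteredNoise P (U 0) σ)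
    (hVG : LinearGrowth V G) (hmon : ∀ x, μ * ‖x - xs‖ ^ 2 - lam ≤ inner ℝ (V x) (x - xs))
    (hγ : 0 ≤ γ) (hγμ : γ * G ^ 2 ≤ μ) :
    GeometricDrift (sgdaKernel P V γ U) (fun x => ‖x - xs‖ ^ 2) (1 - γ * μ / 2)
      (2 * γ * lam + 3 * γ ^ 2 * G ^ 2 * (1 + ‖xs‖) ^ 2 + γ ^ 2 * σ ^ 2) := by
  have hW : Measurable fun x : Vec d => ‖x - xs‖ ^ 2 := by fun_prop
  have hstep (x : Vec d) : Measurable (queryStep V γ (U 0) x x) :=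
    measurable_queryStep hV hu.measurable measurable_const measurable_const measurable_id
  have hsq (x : Vec d) := integral_sq_norm_queryStep_sub_le (V := V) (s := γ) hu x x xs
  refine ⟨hW, fun x => sq_nonneg _, fun x => ?_, fun x => ?_⟩ <;>
    rw [sgdaKernel_apply hV hu.measurable]
  · exact (integrable_map_measure hW.aestronglyMeasurable (hstep x).aemeasurable).2 (hsq x).1
  · rw [integral_map (hstep x).aemeasurable hW.aestronglyMeasurable]
    linarith [(hsq x).2, hVG.sq_norm_sub_smul_le (hmon x) hγ hγμ]

theorem locallyOverlapping_sgdaKernel (hV : Measurable V) (hu : CenteredNoise P (U 0) σ)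
    (hp : PositiveDensityPart P U) (hVG : LinearGrowth V G) (hγ : γ ≠ 0) (xs : Vec d) :
    LocallyOverlapping (sgdaKernel P V γ U) fun x => ‖x - xs‖ ^ 2 := by
  intro r
  obtain ⟨δ, hδ, h⟩ := hVG.exists_haveCommonMass_queryStep hp hu hγ (‖xs‖ + 1 + r)
  refine ⟨δ, hδ, fun x y hx hy => ?_⟩
  rw [sgdaKernel_apply hV hu.measurable, sgdaKernel_apply hV hu.measurable]
  have hx' := norm_le_of_sq_norm_sub_le hx
  have hy' := norm_le_of_sq_norm_sub_le hy
  exact h x x y y hx' hx' hy' hy'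

theorem sgda_bias_le (hγ : 0 < γ) (hμ : 0 < μ) (hlam : 0 ≤ lam) (hγμ : γ * G ^ 2 ≤ μ) {N M : ℝ}
    (hN : N ^ 2 ≤ 2 * M ^ 2 + 2 * (lam / μ)) :
    2 * ((2 * γ * lam + 3 * γ ^ 2 * G ^ 2 * N ^ 2 + γ ^ 2 * σ ^ 2) / (1 - (1 - γ * μ / 2)))
        + 2 * (lam / μ)
      ≤ (24 * G ^ 2 * M ^ 2 + 34 + 4 * σ ^ 2) * (max lam γ / μ) := by
  have hcross : γ * G ^ 2 * (lam / μ) ≤ lam :=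
    (mul_le_mul_of_nonneg_right hγμ (by positivity)).trans_eq (mul_div_cancel₀ lam hμ.ne')
  have hgrowth : γ * G ^ 2 * N ^ 2 ≤ 2 * γ * G ^ 2 * M ^ 2 + 2 * lam := by
    have hmul : γ * G ^ 2 * N ^ 2 ≤ γ * G ^ 2 * (2 * M ^ 2 + 2 * (lam / μ)) := by gcongr
    linarith
  calc 2 * ((2 * γ * lam + 3 * γ ^ 2 * G ^ 2 * N ^ 2 + γ ^ 2 * σ ^ 2) / (1 - (1 - γ * μ / 2)))
        + 2 * (lam / μ)
      = (10 * lam + 12 * (γ * G ^ 2 * N ^ 2) + 4 * σ ^ 2 * γ) / μ := by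
        rw [sub_sub_cancel]
        field_simp
        ring
    _ ≤ (34 * lam + (24 * G ^ 2 * M ^ 2 + 4 * σ ^ 2) * γ) / μ := by
        gcongr ?_ / μ
        linarith
    _ ≤ (34 * max lam γ + (24 * G ^ 2 * M ^ 2 + 4 * σ ^ 2) * max lam γ) / μ := by
        gcongr
        · exact le_max_left _ _
        · exact le_max_right _ _
    _ = (24 * G ^ 2 * M ^ 2 + 34 + 4 * σ ^ 2) * (max lam γ / μ) := by ring

theorem exists_isGeometricLimit_sgda {ℱ : Filtration ℕ mΩ} (hV : Measurable V) {R : ℝ}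
    (hR : ∃ xs ∈ solutions V, ‖xs‖ ≤ R) (hμ : 0 < μ) (hmon : WeakQuasiStronglyMonotone V lam μ)
    (hVG : LinearGrowth V G) (hγ : 0 < γ) (hγμ : γ * G ^ 2 ≤ μ) (hU : OracleNoise P ℱ id U σ)
    (hp : PositiveDensityPart P U) :
    ∃ π : Measure (Vec d), IsGeometricLimit P (sgdaKernel P V γ U) (sgda V γ U) π ∧
      LipschitzBias V π
        ((24 * G ^ 2 * (1 + |R|) ^ 2 + 34 + 4 * σ ^ 2) * (max lam γ / μ)) := by
  obtain ⟨xs, -, hmon⟩ := hmon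
  obtain ⟨z, hz, hzR⟩ := hR
  have hu := hU.centeredNoise 0
  have := isMarkovKernel_sgdaKernel (P := P) (γ := γ) hV hu.measurable
  have hcontract : 1 - γ * μ / 2 < 1 := by linarith [mul_pos hγ hμ]
  obtain ⟨π, hπ, hint, hle⟩ := exists_isGeometricLimit
    (geometricDrift_sgdaKernel hV hu hVG hmon hγ.le hγμ) hcontract
    (locallyOverlapping_sgdaKernel hV hu hp hVG hγ.ne' xs)
    (measurable_and_map_sgda_eq_pow hV hU.iid)
  have := hπ.prob
  have hlam : 0 ≤ lam := by simpa using hmon xs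
  have hnorm : (1 + ‖xs‖) ^ 2 ≤ 2 * (1 + |R|) ^ 2 + 2 * (lam / μ) := by
    have htri : 1 + ‖xs‖ ≤ (1 + |R|) + ‖z - xs‖ := by
      linarith [norm_le_norm_add_norm_sub z xs, le_abs_self R]
    have hsq := pow_le_pow_left₀ (by positivity) htri 2
    linarith [add_sq_le (a := 1 + |R|) (b := ‖z - xs‖), sq_norm_sub_le_of_mem_solutions hμ hmon hz]
  exact ⟨π, hπ, lipschitzBias_of_integral_sq_le hμ hmon hint hle
    (sgda_bias_le hγ hμ hlam hγμ hnorm)⟩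

end SGDA

section SEG

variable {d : ℕ} {V : Vec d → Vec d} {xs : Vec d} {L : ℝ≥0} {σ α γ lam μ : ℝ}

theorem linearGrowth_of_lipschitzWith (hL : LipschitzWith L V) :
    LinearGrowth V (max ‖V 0‖ L) := fun x => by
  have hlip : ‖V x - V 0‖ ≤ L * ‖x‖ := by simpa only [sub_zero] using hL.norm_sub_le x 0
  calc ‖V x‖ ≤ ‖V 0‖ + ‖V x - V 0‖ := norm_le_norm_add_norm_sub' _ _
    _ ≤ max ‖V 0‖ L + max ‖V 0‖ L * ‖x‖ := by
        gcongr
        · exact le_max_left _ _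
        · exact hlip.trans (by gcongr; exact le_max_right _ _)
    _ = max ‖V 0‖ L * (1 + ‖x‖) := by ring

theorem sq_norm_lookahead_sub_le (hL : LipschitzWith L V) (γ : ℝ) (x z : Vec d) :
    ‖V (x - γ • (V x + z)) - (V x + z)‖ ^ 2
      ≤ 3 * (L ^ 2 * γ ^ 2 * ‖V x + z‖ ^ 2) + 3 / 2 * ‖z‖ ^ 2 := by
  set g := V x + z
  have hlip : ‖V (x - γ • g) - V x‖ ≤ L * (|γ| * ‖g‖) := by
    simpa [norm_smul] using hL.norm_sub_le (x - γ • g) x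
  have htri : ‖V (x - γ • g) - g‖ ≤ L * (|γ| * ‖g‖) + ‖z‖ := by
    rw [← sub_sub]
    exact (norm_sub_le _ _).trans (by gcongr)
  calc ‖V (x - γ • g) - g‖ ^ 2 ≤ (L * (|γ| * ‖g‖) + ‖z‖) ^ 2 := by gcongr
    _ ≤ 3 * (L * (|γ| * ‖g‖)) ^ 2 + 3 / 2 * ‖z‖ ^ 2 := by
        linarith [sq_nonneg (2 * (L * (|γ| * ‖g‖)) - ‖z‖)]
    _ = 3 * (L ^ 2 * γ ^ 2 * ‖g‖ ^ 2) + 3 / 2 * ‖z‖ ^ 2 := by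
        rw [mul_pow, mul_pow, sq_abs]
        ring

theorem sq_norm_sub_smul_eq_lookahead {E : Type*} [NormedAddCommGroup E] [InnerProductSpace ℝ E]
    (α γ : ℝ) (e v g : E) :
    ‖e - (α * γ) • v‖ ^ 2 = ‖e‖ ^ 2 - 2 * (α * γ) * inner ℝ v (e - γ • g)
      - α * γ ^ 2 * (‖g‖ ^ 2 - ‖v - g‖ ^ 2) - α * (1 - α) * (γ ^ 2 * ‖v‖ ^ 2) := by
  rw [norm_sub_sq_real, norm_sub_sq_real, inner_sub_right, real_inner_smul_right,
    real_inner_smul_right, norm_smul, mul_pow, Real.norm_eq_abs, sq_abs, real_inner_comm v e]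
  ring

theorem three_mul_sq_add_two_mul_le_one {l : ℝ} (hl : 0 ≤ l) (hγ : 0 ≤ γ) (hμ : 0 ≤ μ)
    (hγμ : γ * (2 * μ + √3 * l) ≤ 1) : 3 * (l ^ 2 * γ ^ 2) + 2 * (γ * μ) ≤ 1 := by
  have hs : 0 ≤ γ * (√3 * l) := by positivity
  have hγμ0 : 0 ≤ γ * μ := by positivity
  calc 3 * (l ^ 2 * γ ^ 2) + 2 * (γ * μ) = (γ * (√3 * l)) ^ 2 + 2 * (γ * μ) := by
        rw [mul_pow, mul_pow, Real.sq_sqrt (by norm_num)]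
        ring
    _ ≤ γ * (√3 * l) + 2 * (γ * μ) := by
        gcongr
        exact pow_le_of_le_one hs (by linarith) two_ne_zero
    _ ≤ 1 := by linarith

theorem sq_norm_sub_smul_lookahead_le (hL : LipschitzWith L V) (hμ : 0 ≤ μ)
    (hmon : ∀ x, μ * ‖x - xs‖ ^ 2 - lam ≤ inner ℝ (V x) (x - xs)) (hα0 : 0 ≤ α) (hα1 : α ≤ 1)
    (hγ : 0 ≤ γ) (hγμ : γ * (2 * μ + √3 * L) ≤ 1) (x z : Vec d) :
    ‖x - xs - (α * γ) • V (x - γ • (V x + z))‖ ^ 2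
      ≤ (1 - α * γ * μ) * ‖x - xs‖ ^ 2 + 2 * α * γ * lam + 3 / 2 * α * γ ^ 2 * ‖z‖ ^ 2 := by
  have hlip := sq_norm_lookahead_sub_le hL γ x z
  set g := V x + z
  have hmony := hmon (x - γ • g)
  rw [sub_right_comm] at hmony
  set e := x - xs
  set v := V (x - γ • g)
  have hcompare : ‖e‖ ^ 2 ≤ 2 * ‖e - γ • g‖ ^ 2 + 2 * (γ ^ 2 * ‖g‖ ^ 2) := by
    have htri : ‖e‖ ≤ ‖e - γ • g‖ + ‖γ • g‖ := norm_le_norm_sub_add _ _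
    have hsq := pow_le_pow_left₀ (norm_nonneg _) htri 2
    have hsmul : ‖γ • g‖ ^ 2 = γ ^ 2 * ‖g‖ ^ 2 := by
      rw [norm_smul, mul_pow, Real.norm_eq_abs, sq_abs]
    linarith [add_sq_le (a := ‖e - γ • g‖) (b := ‖γ • g‖)]
  have hcoef : α * γ ^ 2 * ‖g‖ ^ 2 * (3 * (L ^ 2 * γ ^ 2) + 2 * (γ * μ)) ≤ α * γ ^ 2 * ‖g‖ ^ 2 :=
    mul_le_of_le_one_right (by positivity)
      (three_mul_sq_add_two_mul_le_one L.coe_nonneg hγ hμ hγμ)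
  have hv : 0 ≤ α * (1 - α) * (γ ^ 2 * ‖v‖ ^ 2) :=
    mul_nonneg (mul_nonneg hα0 (sub_nonneg.2 hα1)) (by positivity)
  rw [sq_norm_sub_smul_eq_lookahead α γ e v g]
  linarith [mul_le_mul_of_nonneg_left hmony (by positivity : 0 ≤ 2 * (α * γ)),
    mul_le_mul_of_nonneg_left hlip (by positivity : 0 ≤ α * γ ^ 2),
    mul_le_mul_of_nonneg_left hcompare (by positivity : 0 ≤ α * γ * μ)]

variable {Ω : Type*}

theorem measurable_segStep {m : MeasurableSpace Ω} (hV : Measurable V) {u u' : Vec d → Ω → Vec d}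
    (hu : Measurable[MeasurableSpace.prod inferInstance m] fun q : Vec d × Ω => u q.1 q.2)
    (hu' : Measurable[MeasurableSpace.prod inferInstance m] fun q : Vec d × Ω => u' q.1 q.2) :
    Measurable[MeasurableSpace.prod inferInstance m] fun q : Vec d × Ω =>
      segStep V α γ (fun y => u y q.2) (fun y => u' y q.2) q.1 :=
  measurable_queryStep hV hu' measurable_fst
    (measurable_queryStep hV hu measurable_fst measurable_fst measurable_snd) measurable_snd

theorem indep_iSup_sup [mΩ : MeasurableSpace Ω] {P : Measure Ω} {𝒢 : ℕ ⊕ ℕ → MeasurableSpace Ω}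
    (hle : ∀ k, 𝒢 k ≤ mΩ) (hind : iIndep 𝒢 P) (n : ℕ) :
    Indep (⨆ k ∈ Set.Iio n, 𝒢 (.inl k) ⊔ 𝒢 (.inr k)) (𝒢 (.inl n) ⊔ 𝒢 (.inr n)) P := by
  let time : ℕ ⊕ ℕ → ℕ := Sum.elim id id
  have hdisj : Disjoint (time ⁻¹' Set.Iio n) (time ⁻¹' {n}) :=
    Disjoint.preimage _ (by simp)
  have hmem {S : Set ℕ} {k : ℕ} (hk : k ∈ S) :
      𝒢 (.inl k) ⊔ 𝒢 (.inr k) ≤ ⨆ i ∈ time ⁻¹' S, 𝒢 i :=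
    sup_le (le_biSup 𝒢 (show Sum.inl k ∈ time ⁻¹' S from hk))
      (le_biSup 𝒢 (show Sum.inr k ∈ time ⁻¹' S from hk))
  exact indep_of_indep_of_le_right (indep_of_indep_of_le_left
    (indep_iSup_of_disjoint hle hind hdisj) (iSup₂_le fun k hk => hmem hk))
    (hmem (Set.mem_singleton n))

variable [mΩ : MeasurableSpace Ω] {P : Measure Ω} [IsProbabilityMeasure P]
  {U U' : ℕ → Vec d → Ω → Vec d}

theorem IIDFields.map_segStep_eq_bind (h : IIDFields P (Sum.elim U U')) (hV : Measurable V)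
    (n : ℕ) (x : Vec d) :
    P.map (fun ω => segStep V α γ (fun y => U n y ω) (fun y => U' n y ω) x)
      = (P.map (queryStep V γ (U n) x x)).bind
        (updateKernel P fun y ω => queryStep V (α * γ) (U' n) x y ω) := by
  obtain ⟨𝒢, hle, hind, hmeas⟩ := h.indep
  exact map_eval_eq_bind_updateKernel (hle (.inl n)) (hle (.inr n)) (hind.indep Sum.inl_ne_inr)
    (F := fun y ω => queryStep V (α * γ) (U' n) x y ω)
    (measurable_queryStep hV (hmeas (.inl n)) measurable_const measurable_const measurable_id)
    (measurable_queryStep hV (hmeas (.inr n)) measurable_const measurable_fst measurable_snd)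

theorem IIDFields.updateKernel_segStep_eq (h : IIDFields P (Sum.elim U U')) (hV : Measurable V)
    (n : ℕ) :
    updateKernel P (fun x ω => segStep V α γ (fun y => U n y ω) (fun y => U' n y ω) x)
      = segKernel P V α γ U U' := by
  have hjoint (n : ℕ) := measurable_segStep (α := α) (γ := γ) hV (h.measurable (.inl n))
    (h.measurable (.inr n))
  have hsecond (x : Vec d) := h.updateKernel_queryStep_eq (s := α * γ) hV
    (measurable_const (a := x)) measurable_id (.inr n) (.inr 0)
  have hfirst (x : Vec d) := h.map_queryStep_eq (V := V) (s := γ) (.inl n) (.inl 0) x x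
  ext x : 1
  rw [segKernel, updateKernel_apply (hjoint n), updateKernel_apply (hjoint 0)]
  refine (h.map_segStep_eq_bind hV n x).trans (Eq.trans ?_ (h.map_segStep_eq_bind hV 0 x).symm)
  exact congrArg₂ Measure.bind (hfirst x) (congrArg DFunLike.coe (hsecond x))

theorem measurable_and_map_seg_eq_pow (hV : Measurable V) (h : IIDFields P (Sum.elim U U'))
    (x₀ : Vec d) (n : ℕ) : Measurable (seg V α γ U U' x₀ n) ∧
      P.map (seg V α γ U U' x₀ n) = (segKernel P V α γ U U' ^ n) x₀ := by
  obtain ⟨𝒢, hle, hind, hmeas⟩ := h.indep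
  exact measurable_and_map_eq_pow (fun n => sup_le (hle (.inl n)) (hle (.inr n)))
    (indep_iSup_sup hle hind)
    (F := fun n x ω => segStep V α γ (fun y => U n y ω) (fun y => U' n y ω) x)
    (fun n => measurable_segStep hV (measurable_of_measurable_prod le_sup_left (hmeas (.inl n)))
      (measurable_of_measurable_prod le_sup_right (hmeas (.inr n))))
    (h.updateKernel_segStep_eq hV) rfl (fun n => rfl) n

theorem IIDFields.segKernel_apply (h : IIDFields P (Sum.elim U U')) (hV : Measurable V)
    (x : Vec d) :
    segKernel P V α γ U U' x = (P.map (queryStep V γ (U 0) x x)).bind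
      (updateKernel P fun y ω => queryStep V (α * γ) (U' 0) x y ω) := by
  rw [segKernel, updateKernel_apply
    (measurable_segStep hV (h.measurable (.inl 0)) (h.measurable (.inr 0)))]
  exact h.map_segStep_eq_bind hV 0 x

theorem integral_sq_norm_sub_bind_le (hV : Measurable V) {u : Vec d → Ω → Vec d}
    (hu : CenteredNoise P u σ) {s : ℝ} {x : Vec d} {K : Kernel (Vec d) (Vec d)}
    (hK : ∀ y, K y = P.map (queryStep V s u x y)) {ν : Measure (Vec d)} [IsProbabilityMeasure ν]
    {z : Vec d} (hν : Integrable (fun y => ‖x - z - s • V y‖ ^ 2) ν) :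
    Integrable (fun y => ‖y - z‖ ^ 2) (ν.bind K) ∧
      ∫ y, ‖y - z‖ ^ 2 ∂(ν.bind K) ≤ ∫ y, ‖x - z - s • V y‖ ^ 2 ∂ν + s ^ 2 * σ ^ 2 := by
  have hW : Measurable fun y : Vec d => ‖y - z‖ ^ 2 := by fun_prop
  have hstep (y : Vec d) : Measurable (queryStep V s u x y) :=
    measurable_queryStep hV hu.measurable measurable_const measurable_const measurable_id
  have hsq (y : Vec d) := integral_sq_norm_queryStep_sub_le (V := V) (s := s) hu x y z
  have hWK (y : Vec d) : Integrable (fun y => ‖y - z‖ ^ 2) (K y) := by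
    rw [hK]
    exact (integrable_map_measure hW.aestronglyMeasurable (hstep y).aemeasurable).2 (hsq y).1
  have hle (y : Vec d) : ∫ y, ‖y - z‖ ^ 2 ∂(K y) ≤ ‖x - z - s • V y‖ ^ 2 + s ^ 2 * σ ^ 2 := by
    rw [hK, integral_map (hstep y).aemeasurable hW.aestronglyMeasurable]
    exact (hsq y).2
  obtain ⟨hint, hbind⟩ := integrable_bind_of_integral_le hW (fun y => sq_nonneg _) hWK
    (hν.add (integrable_const (s ^ 2 * σ ^ 2))) hle
  refine ⟨hint, hbind.trans_eq ?_⟩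
  simp [integral_add hν (integrable_const _)]

theorem integral_sq_norm_sub_smul_lookahead_le {u : Vec d → Ω → Vec d}
    (hu : CenteredNoise P u σ) (hL : LipschitzWith L V) (hμ : 0 ≤ μ)
    (hmon : ∀ x, μ * ‖x - xs‖ ^ 2 - lam ≤ inner ℝ (V x) (x - xs)) (hα0 : 0 ≤ α) (hα1 : α ≤ 1)
    (hγ : 0 ≤ γ) (hγμ : γ * (2 * μ + √3 * L) ≤ 1) (x : Vec d) :
    Integrable (fun ω => ‖x - xs - (α * γ) • V (queryStep V γ u x x ω)‖ ^ 2) P ∧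
      ∫ ω, ‖x - xs - (α * γ) • V (queryStep V γ u x x ω)‖ ^ 2 ∂P
        ≤ (1 - α * γ * μ) * ‖x - xs‖ ^ 2 + 2 * α * γ * lam + 3 / 2 * α * γ ^ 2 * σ ^ 2 := by
  have hV : Measurable V := hL.continuous.measurable
  have hY : Measurable (queryStep V γ u x x) :=
    measurable_queryStep hV hu.measurable measurable_const measurable_const measurable_id
  have husq : Integrable (fun ω => 3 / 2 * α * γ ^ 2 * ‖u x ω‖ ^ 2) P :=
    ((memLp_two_iff_integrable_sq_norm (hu.memLp x).1).1 (hu.memLp x)).const_mul _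
  have hle (ω : Ω) := sq_norm_sub_smul_lookahead_le hL hμ hmon hα0 hα1 hγ hγμ x (u x ω)
  have hmajor := (integrable_const
    ((1 - α * γ * μ) * ‖x - xs‖ ^ 2 + 2 * α * γ * lam) (μ := P)).add husq
  have hint : Integrable (fun ω => ‖x - xs - (α * γ) • V (queryStep V γ u x x ω)‖ ^ 2) P :=
    hmajor.mono' (Measurable.aestronglyMeasurable (by fun_prop))
      (ae_of_all _ fun ω => (Real.norm_of_nonneg (sq_nonneg _)).trans_le (hle ω))
  refine ⟨hint, (integral_mono hint hmajor hle).trans ?_⟩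
  simp only [Pi.add_apply]
  rw [integral_add (integrable_const _) husq, integral_const_mul]
  simp only [integral_const, probReal_univ, smul_eq_mul, one_mul]
  gcongr
  exact hu.integral_norm_sq_le x

theorem geometricDrift_segKernel (h : IIDFields P (Sum.elim U U'))
    (hu : CenteredNoise P (U 0) σ) (hu' : CenteredNoise P (U' 0) σ) (hL : LipschitzWith L V)
    (hμ : 0 ≤ μ) (hmon : ∀ x, μ * ‖x - xs‖ ^ 2 - lam ≤ inner ℝ (V x) (x - xs)) (hα0 : 0 ≤ α)
    (hα1 : α ≤ 1) (hγ : 0 ≤ γ) (hγμ : γ * (2 * μ + √3 * L) ≤ 1) :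
    GeometricDrift (segKernel P V α γ U U') (fun x => ‖x - xs‖ ^ 2) (1 - α * γ * μ)
      (2 * α * γ * lam + 3 / 2 * α * γ ^ 2 * σ ^ 2 + (α * γ) ^ 2 * σ ^ 2) := by
  have hV : Measurable V := hL.continuous.measurable
  have hh (x : Vec d) : Measurable fun y => ‖x - xs - (α * γ) • V y‖ ^ 2 := by fun_prop
  have hY (x : Vec d) : Measurable (queryStep V γ (U 0) x x) :=
    measurable_queryStep hV hu.measurable measurable_const measurable_const measurable_id
  have hlook (x : Vec d) :=
    integral_sq_norm_sub_smul_lookahead_le hu hL hμ hmon hα0 hα1 hγ hγμ x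
  have hstep (x : Vec d) : Integrable (fun y => ‖y - xs‖ ^ 2) (segKernel P V α γ U U' x) ∧
      ∫ y, ‖y - xs‖ ^ 2 ∂(segKernel P V α γ U U' x)
        ≤ ∫ y, ‖x - xs - (α * γ) • V y‖ ^ 2 ∂(P.map (queryStep V γ (U 0) x x))
          + (α * γ) ^ 2 * σ ^ 2 := by
    have := Measure.isProbabilityMeasure_map (μ := P) (hY x).aemeasurable
    rw [h.segKernel_apply hV]
    exact integral_sq_norm_sub_bind_le hV hu'
      (updateKernel_apply (F := fun y ω => queryStep V (α * γ) (U' 0) x y ω)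
        (measurable_queryStep hV hu'.measurable measurable_const measurable_fst measurable_snd))
      ((integrable_map_measure (hh x).aestronglyMeasurable (hY x).aemeasurable).2 (hlook x).1)
  refine ⟨by fun_prop, fun x => sq_nonneg _, fun x => (hstep x).1,
    fun x => (hstep x).2.trans ?_⟩
  rw [integral_map (hY x).aemeasurable (hh x).aestronglyMeasurable]
  linarith [(hlook x).2]

theorem LinearGrowth.exists_half_le_measureReal_queryStep {G : ℝ} {u : Vec d → Ω → Vec d}
    (hVG : LinearGrowth V G) (hV : Measurable V) (hu : CenteredNoise P u σ) (s r : ℝ) :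
    ∃ N, ∀ x, ‖x‖ ≤ r → 1 / 2 ≤ (P.map (queryStep V s u x x)).real {y | ‖y‖ ≤ N} := by
  refine ⟨1 + 2 * ((r + |s| * (|G| * (1 + r))) ^ 2 + s ^ 2 * σ ^ 2), fun x hx => ?_⟩
  have hstep : Measurable (queryStep V s u x x) :=
    measurable_queryStep hV hu.measurable measurable_const measurable_const measurable_id
  obtain ⟨hint, hle⟩ := integral_sq_norm_queryStep_sub_le (V := V) (s := s) hu x x 0
  simp only [sub_zero] at hint hle
  have hVx : ‖V x‖ ≤ |G| * (1 + r) := (hVG x).trans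
    (mul_le_mul (le_abs_self G) (by linarith) (by positivity) (abs_nonneg G))
  have hmean : ‖x - s • V x‖ ≤ r + |s| * (|G| * (1 + r)) := by
    refine (norm_sub_le _ _).trans ?_
    rw [norm_smul, Real.norm_eq_abs]
    gcongr
  rw [map_measureReal_apply hstep (measurableSet_le measurable_norm measurable_const)]
  refine half_le_measureReal_norm_le hstep
    ((memLp_two_iff_integrable_sq_norm hstep.aestronglyMeasurable).2 hint) (hle.trans ?_)
  gcongr

theorem locallyOverlapping_segKernel {G : ℝ} (h : IIDFields P (Sum.elim U U'))
    (hu : CenteredNoise P (U 0) σ) (hu' : CenteredNoise P (U' 0) σ)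
    (hp : PositiveDensityPart P (Sum.elim U U')) (hV : Measurable V) (hVG : LinearGrowth V G)
    (hαγ : α * γ ≠ 0) (xs : Vec d) :
    LocallyOverlapping (segKernel P V α γ U U') fun x => ‖x - xs‖ ^ 2 := by
  intro r
  obtain ⟨N, hN⟩ := hVG.exists_half_le_measureReal_queryStep hV hu γ (‖xs‖ + 1 + r)
  obtain ⟨δ, hδ, hoverlap⟩ := hVG.exists_haveCommonMass_queryStep hp (k := .inr 0) hu' hαγ
    (max (‖xs‖ + 1 + r) N)
  have hjoint (x : Vec d) : Measurable fun q : Vec d × Ω => queryStep V (α * γ) (U' 0) x q.1 q.2 :=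
    measurable_queryStep hV hu'.measurable measurable_const measurable_fst measurable_snd
  have hker (x : Vec d) := isMarkovKernel_updateKernel (P := P)
    (F := fun y ω => queryStep V (α * γ) (U' 0) x y ω) (hjoint x)
  refine ⟨1 / 2 * δ, by positivity, fun x x' hx hx' => ?_⟩
  have hxr := norm_le_of_sq_norm_sub_le hx
  have hxr' := norm_le_of_sq_norm_sub_le hx'
  rw [h.segKernel_apply hV, h.segKernel_apply hV]
  refine HaveCommonMass.bind one_half_pos (hN x hxr) (hN x' hxr') fun y hy y' hy' => ?_
  rw [updateKernel_apply (hjoint x), updateKernel_apply (hjoint x')]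
  exact hoverlap x y x' y' (le_max_of_le_left hxr) (le_max_of_le_right hy)
    (le_max_of_le_left hxr') (le_max_of_le_right hy')

theorem seg_bias_le (hα : 0 < α) (hγ : 0 < γ) (hμ : 0 < μ) :
    2 * ((2 * α * γ * lam + 3 / 2 * α * γ ^ 2 * σ ^ 2 + (α * γ) ^ 2 * σ ^ 2)
        / (1 - (1 - α * γ * μ))) + 2 * (lam / μ)
      ≤ (6 + (3 + 2 * α) * σ ^ 2) * (max lam γ / μ) := by
  calc 2 * ((2 * α * γ * lam + 3 / 2 * α * γ ^ 2 * σ ^ 2 + (α * γ) ^ 2 * σ ^ 2)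
        / (1 - (1 - α * γ * μ))) + 2 * (lam / μ)
      = (6 * lam + (3 + 2 * α) * σ ^ 2 * γ) / μ := by
        rw [sub_sub_cancel]
        field_simp
        ring
    _ ≤ (6 * max lam γ + (3 + 2 * α) * σ ^ 2 * max lam γ) / μ := by
        gcongr
        · exact le_max_left _ _
        · exact le_max_right _ _
    _ = (6 + (3 + 2 * α) * σ ^ 2) * (max lam γ / μ) := by ring

theorem exists_isGeometricLimit_seg {ℱ : Filtration ℕ mΩ} {time : ℕ ⊕ ℕ → ℕ}
    (hL : LipschitzWith L V) (hμ : 0 < μ) (hmon : WeakQuasiStronglyMonotone V lam μ) (hα0 : 0 < α)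
    (hα1 : α ≤ 1) (hγ : 0 < γ) (hγμ : γ * (2 * μ + √3 * L) ≤ 1)
    (hU : OracleNoise P ℱ time (Sum.elim U U') σ) (hp : PositiveDensityPart P (Sum.elim U U')) :
    ∃ π : Measure (Vec d), IsGeometricLimit P (segKernel P V α γ U U') (seg V α γ U U') π ∧
      LipschitzBias V π ((6 + (3 + 2 * α) * σ ^ 2) * (max lam γ / μ)) := by
  obtain ⟨xs, -, hmon⟩ := hmon
  have hV : Measurable V := hL.continuous.measurable
  have hu := hU.centeredNoise (.inl 0)
  have hu' := hU.centeredNoise (.inr 0)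
  have : IsMarkovKernel (segKernel P V α γ U U') :=
    isMarkovKernel_updateKernel (measurable_segStep hV hu.measurable hu'.measurable)
  have hcontract : 1 - α * γ * μ < 1 := by linarith [mul_pos (mul_pos hα0 hγ) hμ]
  obtain ⟨π, hπ, hint, hle⟩ := exists_isGeometricLimit
    (geometricDrift_segKernel hU.iid hu hu' hL hμ.le hmon hα0.le hα1 hγ.le hγμ) hcontract
    (locallyOverlapping_segKernel hU.iid hu hu' hp hV (linearGrowth_of_lipschitzWith hL)
      (mul_pos hα0 hγ).ne' xs)
    (measurable_and_map_seg_eq_pow hV hU.iid)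
  have := hπ.prob
  exact ⟨π, hπ, lipschitzBias_of_integral_sq_le hμ hmon hint hle (seg_bias_le hα0 hγ hμ)⟩

end SEG

end StochVI

theorem mainTheorem1 :
    -- SGDA
    (∀ G R σ : ℝ, 0 < G → 0 < σ → ∃ K : ℝ, 0 < K ∧
      ∀ (d : ℕ) (V : StochVI.Vec d → StochVI.Vec d) (lam μ γ : ℝ),
        Measurable V →
        (∃ xs ∈ StochVI.solutions V, ‖xs‖ ≤ R) →
        0 ≤ lam → 0 < μ → StochVI.WeakQuasiStronglyMonotone V lam μ →
        StochVI.LinearGrowth V G →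
        0 < γ → γ < μ / G ^ 2 →
        ∀ (Ω : Type u) [mΩ : MeasurableSpace Ω] (P : MeasureTheory.Measure Ω)
          [MeasureTheory.IsProbabilityMeasure P] (ℱ : MeasureTheory.Filtration ℕ mΩ)
          (U : ℕ → StochVI.Vec d → Ω → StochVI.Vec d),
          StochVI.OracleNoise P ℱ id U σ →
          StochVI.PositiveDensityPart P U →
          ∃ π : MeasureTheory.Measure (StochVI.Vec d),
            StochVI.IsGeometricLimit P (StochVI.sgdaKernel P V γ U) (StochVI.sgda V γ U) π ∧
            StochVI.LipschitzBias V π (K * (max lam γ / μ))) ∧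
    -- SEG
    (∀ α σ : ℝ, 0 < α → α < 1 → 0 < σ → ∃ K : ℝ, 0 < K ∧
      ∀ (d : ℕ) (V : StochVI.Vec d → StochVI.Vec d) (L : NNReal) (R lam μ γ : ℝ),
        (∃ xs ∈ StochVI.solutions V, ‖xs‖ ≤ R) →
        0 ≤ lam → 0 < μ → StochVI.WeakQuasiStronglyMonotone V lam μ →
        LipschitzWith L V →
        0 < γ → γ < 1 / (2 * μ + √3 * L) →
        ∀ (Ω : Type u) [mΩ : MeasurableSpace Ω] (P : MeasureTheory.Measure Ω)
          [MeasureTheory.IsProbabilityMeasure P] (ℱ : MeasureTheory.Filtration ℕ mΩ)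
          (U U' : ℕ → StochVI.Vec d → Ω → StochVI.Vec d),
          StochVI.OracleNoise P ℱ (Sum.elim id id) (Sum.elim U U') σ →
          StochVI.PositiveDensityPart P (Sum.elim U U') →
          ∃ π : MeasureTheory.Measure (StochVI.Vec d),
            StochVI.IsGeometricLimit P (StochVI.segKernel P V α γ U U')
              (StochVI.seg V α γ U U') π ∧
            StochVI.LipschitzBias V π (K * (max lam γ / μ))) := by
  constructor
  · intro G R σ hG hσ
    refine ⟨24 * G ^ 2 * (1 + |R|) ^ 2 + 34 + 4 * σ ^ 2, by positivity, ?_⟩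
    intro d V lam μ γ hV hR _ hμ hmon hVG hγ hγμ Ω _ P _ ℱ U hU hp
    exact StochVI.exists_isGeometricLimit_sgda hV hR hμ hmon hVG hγ
      ((lt_div_iff₀ (by positivity)).1 hγμ).le hU hp
  · intro α σ hα0 hα1 hσ
    refine ⟨6 + (3 + 2 * α) * σ ^ 2, by positivity, ?_⟩
    intro d V L R lam μ γ _ _ hμ hmon hL hγ hγμ Ω _ P _ ℱ U U' hU hp
    exact StochVI.exists_isGeometricLimit_seg hL hμ hmon hα0 hα1.le hγ
      ((lt_div_iff₀ (by positivity)).1 hγμ).le hU hp
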